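/- Let $d\ge 2$. For $\varepsilon>0$ put $z_\varepsilon=1+i\varepsilon$ and let $\chi_\varepsilon$ be the indicator function of the tube $T_\varepsilon=\{x=(x_1,x')\in\mathbb{R}\times\mathbb{R}^{d-1}:\ |x_1|<\varepsilon^{-1},\ |x'|<\varepsilon^{-1/2}\}$. For measurable $V:\mathbb{R}^d\to\mathbb{C}$ and $E>0$ let $$F_V(E)=\sup_{y\in\mathbb{R}^d}\int_{\mathbb{R}^d}|V(x)|^{\frac{d+1}{2}}e^{-E|x-y|}\,dx\in[0,\infty].$$ There are measurable potentials $V_\varepsilon:\mathbb{R}^d\to\mathbb{C}$, $\varepsilon>0$, and constants $C_d,C_d',\varepsilon_d>0$ depending only on $d$, such that 1. for every $\varepsilon>0$, $V_\varepsilon$ is bounded, vanishes outside $T_\varepsilon$, and $z_\varepsilon$ is an eigenvalue of the Schrödinger operator $-\Delta+V_\varepsilon$ on $L^2(\mathbb{R}^d)$ with domain $H^2(\mathbb{R}^d)=\{u\in L^2:\Delta u\in L^2\}$; 2. $|V_\varepsilon|\le C_d\,\varepsilon\,\chi_\varepsilon$ for $0<\varepsilon<\varepsilon_d$; 3. for all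 $L\ge 1$, $$\liminf_{\varepsilon\to 0^+}\frac{|z_\varepsilon|^{1/2}}{F_{V_\varepsilon}(L\,\operatorname{Im}\sqrt{z_\varepsilon})}\ \ge\ C_d'\,L,$$ where $\sqrt{\cdot}$ is the principal branch of the square root (so $\operatorname{Im}\sqrt{z_\varepsilon}>0$). -/

import Mathlib

open MeasureTheory Filter Topology
open scoped ENNReal Laplacian

noncomputable section

/-- The Hilbert space `L²(ℝᵈ)` of complex-valued functions. -/
abbrev L2 (d : ℕ) : Type :=
  Lp ℂ 2 (volume : Measure (EuclideanSpace ℝ (Fin d)))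

/-- `SchrodingerMaps V u f` says that `u` is in the domain of the Schrödinger operator
`H_V = -Δ + V` on `L²(ℝᵈ)` and that `H_V u = f`: the distributional Laplacian of `u` is a
function `g ∈ L²`, and `f = -g + V u` (an equality in `L²`, i.e. almost everywhere).
For bounded measurable `V` the domain is `{u ∈ L² : Δ u ∈ L²} = H²(ℝᵈ)`. -/
def SchrodingerMaps {d : ℕ} (V : EuclideanSpace ℝ (Fin d) → ℂ) (u f : L2 d) : Prop :=
  ∃ g : L2 d,
    Δ (Lp.toTemperedDistribution u) = Lp.toTemperedDistribution g ∧
    ∀ᵐ x ∂(volume : Measure (EuclideanSpace ℝ (Fin d))), f x = -g x + V x * u x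

/-- `z` is an eigenvalue of `H_V = -Δ + V`: there is a nonzero `ψ` in the domain of `H_V` with
`H_V ψ = z ψ`. -/
def IsSchrodingerEigenvalue {d : ℕ} (V : EuclideanSpace ℝ (Fin d) → ℂ) (z : ℂ) : Prop :=
  ∃ ψ : L2 d, ψ ≠ 0 ∧ SchrodingerMaps V ψ (z • ψ)

/-- The tube `T_ε = {x = (x₁, x') ∈ ℝ × ℝᵈ⁻¹ : |x₁| < ε⁻¹, |x'| < ε^(-1/2)}`, where `|x'|` is the
Euclidean norm. -/
def tube (d : ℕ) [NeZero d] (ε : ℝ) : Set (EuclideanSpace ℝ (Fin d)) :=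
  {x | |x 0| < ε⁻¹ ∧ √(∑ i ∈ Finset.univ.erase (0 : Fin d), x i ^ 2) < ε ^ (-1 / 2 : ℝ)}

/-- The indicator function `χ_ε` of the tube `T_ε`. -/
def tubeIndicator (d : ℕ) [NeZero d] (ε : ℝ) : EuclideanSpace ℝ (Fin d) → ℝ :=
  (tube d ε).indicator (fun _ => 1)

/-- The point `z_ε = 1 + i ε`. -/
def zEps (ε : ℝ) : ℂ := 1 + Complex.I * (ε : ℂ)

/-- `F_V(E) = sup_y ∫ |V(x)|^((d+1)/2) exp(-E |x - y|) dx`, with values in `[0, ∞]`. -/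
def daviesNath {d : ℕ} (V : EuclideanSpace ℝ (Fin d) → ℂ) (E : ℝ) : ℝ≥0∞ :=
  ⨆ y : EuclideanSpace ℝ (Fin d), ∫⁻ x : EuclideanSpace ℝ (Fin d),
    ENNReal.ofReal (‖V x‖ ^ (((d : ℝ) + 1) / 2) * Real.exp (-E * ‖x - y‖))

end

/-! Write `R = (-Δ - z)⁻¹` and `B = -i χ_T R χ_T` with `z = z_ε`, and suppose `B f = s • conj f`
with `s > 0`, `f ≠ 0`. Put `ψ = R f`. Since `f` lives on `T` and `ψ = i s conj f` there, `V = i f /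
(s conj f)` satisfies `V ψ = -f`, that is, `(-Δ + V) ψ = z ψ`. As `f / conj f` is unimodular, `|V| ≤
1/s`, so the task is to make `s` as large as a multiple of `1/ε`.

Such an `f` comes from a variational problem. `B` equals its transpose for the bilinear form `∫ f
g`, and it is compact; hence `conj ∘ B` is compact, real-linear and symmetric for `Re ⟪·,·⟫`, and
its largest Rayleigh quotient is an eigenvalue (`exists_eigenvector_of_symmetric`). For real `u`
supported in `T` the quadratic form is `Im ⟪u, R u⟫ = Im z ‖R u‖²`, and a real quasimode with `‖(-Δ
- z) u‖ ≤ K ‖u‖` forces `‖R u‖ ≥ ‖u‖ / K` by duality. Thus `1/s ≤ K² / Im z` (`exists_potential`).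

The quasimode is `cos (x₁ + θ) Φ(ε x₁, √ε x')` with a fixed bump `Φ`: the scaling fits the tube and
makes every error term `O(ε)`, so `K ~ ε` and `|V| ≲ ε` (`exists_test_function`). The same scaling
is critical for the integral defining `F_V`: the powers of `ε` cancel and a factor `1/L` remains
(`tube_scaling`). -/

noncomputable section

section Analysis

open FourierTransform SchwartzMap
open scoped InnerProductSpace

/-! ### Multiplication and conjugation on `L²`. -/

section MultiplicationOperator

variable {α : Type*} [MeasurableSpace α] {μ : Measure α}

/-- Multiplication by an essentially bounded function, as an operator on `L²`. -/
def mulOp {g : α → ℂ} (hg : MemLp g ∞ μ) : Lp ℂ 2 μ →L[ℂ] Lp ℂ 2 μ :=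
  (ContinuousLinearMap.mul ℂ ℂ).holderL μ ∞ 2 2 (hg.toLp g)

theorem coeFn_mulOp {g : α → ℂ} (hg : MemLp g ∞ μ) (f : Lp ℂ 2 μ) :
    mulOp hg f =ᵐ[μ] fun x => g x * f x := by
  filter_upwards [(ContinuousLinearMap.mul ℂ ℂ).coeFn_holder (r := 2) (hg.toLp g) f,
    hg.coeFn_toLp] with x h1 h2
  change ((ContinuousLinearMap.mul ℂ ℂ).holder 2 (hg.toLp g) f) x = _
  rw [h1, h2]; rfl

/-- Complex conjugation on `L²`. -/
def conjOp (μ : Measure α) : Lp ℂ 2 μ →L[ℝ] Lp ℂ 2 μ :=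
  (Complex.conjCLE : ℂ →L[ℝ] ℂ).compLpL 2 μ

theorem coeFn_conjOp (f : Lp ℂ 2 μ) : conjOp μ f =ᵐ[μ] fun x => starRingEnd ℂ (f x) := by
  filter_upwards [(Complex.conjCLE : ℂ →L[ℝ] ℂ).coeFn_compLpL (p := 2) (μ := μ) f] with x hx
  change ((Complex.conjCLE : ℂ →L[ℝ] ℂ).compLpL 2 μ f) x = _
  rw [hx]; simp

/-- Conjugating the first slot produces the symmetric bilinear form `∫ f g`; all transposes below
are taken with respect to it. -/
theorem inner_conjOp_left (f g : Lp ℂ 2 μ) : ⟪conjOp μ f, g⟫_ℂ = ∫ x, f x * g x ∂μ := by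
  rw [L2.inner_def]
  refine integral_congr_ae ?_
  filter_upwards [coeFn_conjOp f] with x hx
  rw [hx]; simp [mul_comm]

theorem inner_conjOp_comm (f g : Lp ℂ 2 μ) : ⟪conjOp μ f, g⟫_ℂ = ⟪conjOp μ g, f⟫_ℂ := by
  simp only [inner_conjOp_left, mul_comm]

theorem norm_conjOp (f : Lp ℂ 2 μ) : ‖conjOp μ f‖ = ‖f‖ := by
  rw [Lp.norm_def, Lp.norm_def]
  congr 1
  refine eLpNorm_congr_norm_ae ?_
  filter_upwards [coeFn_conjOp f] with x hx
  rw [hx]; simp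

theorem conjOp_conjOp (f : Lp ℂ 2 μ) : conjOp μ (conjOp μ f) = f := by
  refine Lp.ext ?_
  filter_upwards [coeFn_conjOp f, coeFn_conjOp (conjOp μ f)] with x h1 h2
  rw [h2, h1]; simp

theorem conjOp_smul (c : ℂ) (f : Lp ℂ 2 μ) :
    conjOp μ (c • f) = starRingEnd ℂ c • conjOp μ f := by
  refine Lp.ext ?_
  filter_upwards [coeFn_conjOp f, coeFn_conjOp (c • f), Lp.coeFn_smul c f,
    Lp.coeFn_smul (starRingEnd ℂ c) (conjOp μ f)] with x h1 h2 h3 h4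
  rw [h2, h3, h4, Pi.smul_apply, Pi.smul_apply, h1]; simp

theorem inner_conjOp_mulOp {g : α → ℂ} (hg : MemLp g ∞ μ) (f h : Lp ℂ 2 μ) :
    ⟪conjOp μ (mulOp hg f), h⟫_ℂ = ⟪conjOp μ f, mulOp hg h⟫_ℂ := by
  rw [inner_conjOp_left, inner_conjOp_left]
  refine integral_congr_ae ?_
  filter_upwards [coeFn_mulOp hg f, coeFn_mulOp hg h] with x h1 h2
  rw [h1, h2]; ring

end MultiplicationOperator

/-! ### The free resolvent through the Fourier transform. -/

section Resolvent

variable {E : Type*} [NormedAddCommGroup E] [InnerProductSpace ℝ E] [FiniteDimensional ℝ E]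
  [MeasurableSpace E] [BorelSpace E]

/-- The symbol `4π²|ξ|² - z` of `-Δ - z`. -/
def helmholtzSymbol (z : ℂ) (ξ : E) : ℂ := ((2 * Real.pi) ^ 2 * ‖ξ‖ ^ 2 : ℝ) - z

omit [InnerProductSpace ℝ E] [FiniteDimensional ℝ E] [MeasurableSpace E] [BorelSpace E] in
theorem im_le_norm_helmholtzSymbol (z : ℂ) (ξ : E) : |z.im| ≤ ‖helmholtzSymbol z ξ‖ := by
  have h : (helmholtzSymbol z ξ).im = -z.im := by
    rw [helmholtzSymbol, Complex.sub_im, Complex.ofReal_im, zero_sub]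
  simpa [h] using Complex.abs_im_le_norm (helmholtzSymbol z ξ)

omit [InnerProductSpace ℝ E] [FiniteDimensional ℝ E] [MeasurableSpace E] [BorelSpace E] in
theorem helmholtzSymbol_ne_zero {z : ℂ} (hz : z.im ≠ 0) (ξ : E) : helmholtzSymbol z ξ ≠ 0 := by
  have := im_le_norm_helmholtzSymbol z ξ
  have h2 : 0 < |z.im| := abs_pos.mpr hz
  exact norm_pos_iff.mp (h2.trans_le this)

omit [InnerProductSpace ℝ E] [FiniteDimensional ℝ E] [MeasurableSpace E] [BorelSpace E] in
theorem continuous_helmholtzSymbol (z : ℂ) : Continuous (helmholtzSymbol z : E → ℂ) := by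
  unfold helmholtzSymbol; fun_prop

theorem memLp_inv_helmholtzSymbol {z : ℂ} (hz : z.im ≠ 0) :
    MemLp (fun ξ : E => (helmholtzSymbol z ξ)⁻¹) ∞ volume := by
  refine memLp_top_of_bound (((continuous_helmholtzSymbol z).inv₀
    (helmholtzSymbol_ne_zero hz)).aestronglyMeasurable) (|z.im|)⁻¹ (ae_of_all _ fun ξ => ?_)
  rw [norm_inv]
  exact inv_anti₀ (abs_pos.mpr hz) (im_le_norm_helmholtzSymbol z ξ)

/-- The resolvent `(-Δ - z)⁻¹` on `L²`. -/
def freeResolvent {z : ℂ} (hz : z.im ≠ 0) :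
    Lp ℂ 2 (volume : Measure E) →L[ℂ] Lp ℂ 2 (volume : Measure E) :=
  (Lp.fourierTransformₗᵢ E ℂ).symm.toContinuousLinearEquiv.toContinuousLinearMap ∘L
    mulOp (memLp_inv_helmholtzSymbol hz) ∘L
      (Lp.fourierTransformₗᵢ E ℂ).toContinuousLinearEquiv.toContinuousLinearMap

theorem fourier_freeResolvent {z : ℂ} (hz : z.im ≠ 0) (f : Lp ℂ 2 (volume : Measure E)) :
    𝓕 (freeResolvent hz f) = mulOp (memLp_inv_helmholtzSymbol hz) (𝓕 f) :=
  (Lp.fourierTransformₗᵢ E ℂ).apply_symm_apply _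

omit [FiniteDimensional ℝ E] [MeasurableSpace E] [BorelSpace E] in
theorem hasTemperateGrowth_normSq :
    (fun x : E => Complex.ofReal (‖x‖ ^ 2)).HasTemperateGrowth := by fun_prop

theorem fourier_laplacian_apply (u : 𝓢'(E, ℂ)) (w : 𝓢(E, ℂ)) :
    𝓕 (Δ u) w = -(2 * Real.pi) ^ 2 *
      (𝓕 u) (SchwartzMap.smulLeftCLM ℂ (fun x : E => Complex.ofReal (‖x‖ ^ 2)) w) := by
  rw [TemperedDistribution.laplacian_eq_fourierMultiplierCLM, ← Complex.coe_smul,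
    TemperedDistribution.fourierMultiplierCLM_apply, FourierTransform.fourier_smul,
    FourierTransform.fourier_fourierInv_eq]
  simp

theorem laplacian_freeResolvent {z : ℂ} (hz : z.im ≠ 0) (f : Lp ℂ 2 (volume : Measure E)) :
    Δ (Lp.toTemperedDistribution (freeResolvent hz f)) =
      Lp.toTemperedDistribution (-(f + z • freeResolvent hz f)) := by
  have key : 𝓕 (Δ (Lp.toTemperedDistribution (freeResolvent hz f))) =
      𝓕 (Lp.toTemperedDistribution (-(f + z • freeResolvent hz f))) := by
    rw [Lp.fourier_toTemperedDistribution_eq]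
    ext w
    rw [fourier_laplacian_apply, Lp.fourier_toTemperedDistribution_eq,
      Lp.toTemperedDistribution_apply, Lp.toTemperedDistribution_apply, ← integral_const_mul]
    refine integral_congr_ae ?_
    have e : 𝓕 (-(f + z • freeResolvent hz f)) = -(𝓕 f + z • 𝓕 (freeResolvent hz f)) := by
      rw [← neg_one_smul ℂ, FourierTransform.fourier_smul, FourierTransform.fourier_add,
        FourierTransform.fourier_smul, neg_one_smul]
    rw [e, fourier_freeResolvent]
    filter_upwards [coeFn_mulOp (memLp_inv_helmholtzSymbol hz) (𝓕 f),
      Lp.coeFn_neg (𝓕 f + z • mulOp (memLp_inv_helmholtzSymbol hz) (𝓕 f)),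
      Lp.coeFn_add (𝓕 f) (z • mulOp (memLp_inv_helmholtzSymbol hz) (𝓕 f)),
      Lp.coeFn_smul z (mulOp (memLp_inv_helmholtzSymbol hz) (𝓕 f))] with x h1 h2 h3 h4
    rw [h2, Pi.neg_apply, h3, Pi.add_apply, h4, Pi.smul_apply, h1,
      SchwartzMap.smulLeftCLM_apply_apply hasTemperateGrowth_normSq]
    have h0 := helmholtzSymbol_ne_zero hz x
    have hs : (((2 * Real.pi) ^ 2 * ‖x‖ ^ 2 : ℝ) : ℂ) = helmholtzSymbol z x + z := by
      simp [helmholtzSymbol]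
    push_cast at hs
    simp only [smul_eq_mul]
    push_cast
    field_simp
    linear_combination (-(w x * (𝓕 f : Lp ℂ 2 volume) x)) * hs
  have := congrArg 𝓕⁻ key
  simpa using this

/-- On the Fourier side the equation says that a nowhere vanishing symbol times `𝓕 u` is zero.
Smooth compactly supported test functions suffice to see this almost everywhere. -/
theorem eq_zero_of_laplacian_eq {z : ℂ} (hz : z.im ≠ 0) {u : Lp ℂ 2 (volume : Measure E)}
    (hu : Δ (Lp.toTemperedDistribution u) = -(z • Lp.toTemperedDistribution u)) : u = 0 := by
  have hint : LocallyIntegrable (fun ξ => helmholtzSymbol z ξ * (𝓕 u : Lp ℂ 2 volume) ξ)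
      (volume : Measure E) := by
    rw [← locallyIntegrableOn_univ]
    exact (((Lp.memLp (𝓕 u)).locallyIntegrable
      (by norm_num)).locallyIntegrableOn _).continuousOn_mul
      (continuous_helmholtzSymbol z).continuousOn isOpen_univ.isLocallyClosed
  have h0 : ∀ᵐ ξ ∂(volume : Measure E), helmholtzSymbol z ξ * (𝓕 u : Lp ℂ 2 volume) ξ = 0 := by
    refine ae_eq_zero_of_integral_contDiff_smul_eq_zero hint fun g g_smooth g_cpt => ?_
    have hg₁ : HasCompactSupport (Complex.ofRealCLM ∘ g) := g_cpt.comp_left rfl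
    have hg₂ : ContDiff ℝ (⊤ : ℕ∞) (Complex.ofRealCLM ∘ g) :=
      Complex.ofRealCLM.contDiff.comp g_smooth
    set φ : 𝓢(E, ℂ) := hg₁.toSchwartzMap hg₂ with hφ
    have h1 : 𝓕 (Lp.toTemperedDistribution u) ((((2 * Real.pi) ^ 2 : ℝ) : ℂ) •
        SchwartzMap.smulLeftCLM ℂ (fun x : E => Complex.ofReal (‖x‖ ^ 2)) φ - z • φ) = 0 := by
      have h2 := DFunLike.congr_fun (congrArg 𝓕 hu) φ
      rw [fourier_laplacian_apply, ← neg_smul, FourierTransform.fourier_smul] at h2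
      rw [map_sub, map_smul, map_smul]
      simp only [smul_eq_mul]
      change _ = -z * 𝓕 (Lp.toTemperedDistribution u) φ at h2
      rw [show (((2 * Real.pi) ^ 2 : ℝ) : ℂ) = (2 * Real.pi : ℂ) ^ 2 by push_cast; ring]
      linear_combination -h2
    rw [Lp.fourier_toTemperedDistribution_eq, Lp.toTemperedDistribution_apply] at h1
    rw [← h1]
    refine integral_congr_ae (ae_of_all _ fun ξ => ?_)
    have h3 : φ ξ = (g ξ : ℂ) := rfl
    simp only [sub_apply, smul_apply,
      SchwartzMap.smulLeftCLM_apply_apply hasTemperateGrowth_normSq, h3, smul_eq_mul,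
      helmholtzSymbol, Complex.real_smul]
    push_cast
    ring
  have h1 : 𝓕 u = 0 := by
    refine Lp.ext ?_
    filter_upwards [h0, Lp.coeFn_zero ℂ 2 (volume : Measure E)] with x h2 h3
    rw [h3]
    simpa [helmholtzSymbol_ne_zero hz] using h2
  rw [← norm_eq_zero, ← Lp.norm_fourier_eq, h1, norm_zero]

theorem toTemperedDistribution_eq_inner (u : Lp ℂ 2 (volume : Measure E)) (w : 𝓢(E, ℂ)) :
    Lp.toTemperedDistribution u w = ⟪conjOp volume (w.toLp 2), u⟫_ℂ := by
  rw [Lp.toTemperedDistribution_apply, inner_conjOp_left]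
  refine integral_congr_ae ?_
  filter_upwards [w.coeFn_toLp 2 volume] with x hx
  rw [hx, smul_eq_mul]

/-- This is the distributional resolvent equation tested on `w`, hence the transpose identity on the
range of `-Δ - z` over Schwartz functions. -/
theorem inner_conjOp_freeResolvent_helmholtz {z : ℂ} (hz : z.im ≠ 0)
    (f : Lp ℂ 2 (volume : Measure E)) (w : 𝓢(E, ℂ)) :
    ⟪conjOp volume (freeResolvent hz f), (-Δ w - z • w).toLp 2⟫_ℂ =
      ⟪conjOp volume f, w.toLp 2⟫_ℂ := by
  have h := DFunLike.congr_fun (laplacian_freeResolvent hz f) w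
  rw [TemperedDistribution.laplacian_apply_apply, toTemperedDistribution_eq_inner _ w] at h
  rw [inner_conjOp_comm, ← toTemperedDistribution_eq_inner, inner_conjOp_comm f, map_sub, map_neg,
    map_smul, h, inner_neg_right, inner_add_right, inner_smul_right,
    toTemperedDistribution_eq_inner, smul_eq_mul]
  ring

/-- Dual form of the density of that range: a function orthogonal to it solves the homogeneous
equation in the sense of distributions. -/
theorem eq_zero_of_inner_helmholtz_eq_zero {z : ℂ} (hz : z.im ≠ 0)
    {v : Lp ℂ 2 (volume : Measure E)}
    (hv : ∀ w : 𝓢(E, ℂ), ⟪conjOp volume v, (-Δ w - z • w).toLp 2⟫_ℂ = 0) : v = 0 := by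
  refine eq_zero_of_laplacian_eq hz ?_
  ext w
  have h := hv w
  rw [inner_conjOp_comm, ← toTemperedDistribution_eq_inner, map_sub, map_neg, map_smul] at h
  rw [TemperedDistribution.laplacian_apply_apply]
  change _ = -(z • Lp.toTemperedDistribution v w)
  linear_combination -h

theorem freeResolvent_helmholtz {z : ℂ} (hz : z.im ≠ 0) (w : 𝓢(E, ℂ)) :
    freeResolvent hz ((-Δ w - z • w).toLp 2) = w.toLp 2 := by
  set g : Lp ℂ 2 (volume : Measure E) := (-Δ w - z • w).toLp 2 with hg
  have hg' : g = -((Δ w).toLp 2 volume) - z • w.toLp 2 volume := by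
    let T : 𝓢(E, ℂ) →L[ℂ] Lp ℂ 2 (volume : Measure E) := SchwartzMap.toLpCLM ℂ ℂ 2 volume
    change T (-Δ w - z • w) = -T (Δ w) - z • T w
    rw [map_sub, map_neg, map_smul]
  rw [← sub_eq_zero]
  refine eq_zero_of_laplacian_eq hz ?_
  have h1 : ∀ u v : Lp ℂ 2 (volume : Measure E), Lp.toTemperedDistribution (u - v) =
      Lp.toTemperedDistribution u - Lp.toTemperedDistribution v := fun u v =>
    map_sub (Lp.toTemperedDistributionCLM ℂ volume 2) u v
  have h2 : ∀ u v : Lp ℂ 2 (volume : Measure E), Lp.toTemperedDistribution (u + v) =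
      Lp.toTemperedDistribution u + Lp.toTemperedDistribution v := fun u v =>
    map_add (Lp.toTemperedDistributionCLM ℂ volume 2) u v
  have h3 : ∀ u : Lp ℂ 2 (volume : Measure E), Lp.toTemperedDistribution (-u) =
      -Lp.toTemperedDistribution u := fun u =>
    map_neg (Lp.toTemperedDistributionCLM ℂ volume 2) u
  have h4 : ∀ u : Lp ℂ 2 (volume : Measure E), Lp.toTemperedDistribution (z • u) =
      z • Lp.toTemperedDistribution u := fun u =>
    map_smul (Lp.toTemperedDistributionCLM ℂ volume 2) z u
  have h5 : Δ (Lp.toTemperedDistribution (w.toLp 2 : Lp ℂ 2 (volume : Measure E))) =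
      Lp.toTemperedDistribution ((Δ w).toLp 2 : Lp ℂ 2 (volume : Measure E)) := by
    rw [Lp.toTemperedDistribution_toLp_eq, Lp.toTemperedDistribution_toLp_eq,
      TemperedDistribution.laplacian_toTemperedDistributionCLM_eq]
  have h6 : ∀ u v : 𝓢'(E, ℂ), Δ (u - v) = Δ u - Δ v := fun u v =>
    map_sub (LineDeriv.laplacianCLM ℝ E 𝓢'(E, ℂ)) u v
  rw [h1, h6, h5, laplacian_freeResolvent]
  simp only [h1, h2, h3, h4, hg']
  module

/-- The two sides agree when `g = (-Δ - z) w`, and these `g` are dense. -/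
theorem inner_conjOp_freeResolvent {z : ℂ} (hz : z.im ≠ 0) (f g : Lp ℂ 2 (volume : Measure E)) :
    ⟪conjOp volume (freeResolvent hz f), g⟫_ℂ = ⟪conjOp volume f, freeResolvent hz g⟫_ℂ := by
  rw [← ContinuousLinearMap.adjoint_inner_left, ← sub_eq_zero, ← inner_sub_left]
  set a := conjOp volume (freeResolvent hz f) -
    ContinuousLinearMap.adjoint (freeResolvent hz) (conjOp volume f) with ha
  have h : conjOp volume a = 0 := by
    refine eq_zero_of_inner_helmholtz_eq_zero hz fun w => ?_
    rw [conjOp_conjOp, ha, inner_sub_left, ContinuousLinearMap.adjoint_inner_left,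
      freeResolvent_helmholtz, inner_conjOp_freeResolvent_helmholtz, sub_self]
  rw [← norm_eq_zero, norm_conjOp, norm_eq_zero] at h
  rw [h, inner_zero_left]

/-- By Plancherel, since `Im (1/p) = -Im p / |p|² = Im z / |p|²` for the symbol `p`. -/
theorem im_inner_freeResolvent {z : ℂ} (hz : z.im ≠ 0) (f : Lp ℂ 2 (volume : Measure E)) :
    (⟪f, freeResolvent hz f⟫_ℂ).im = z.im * ‖freeResolvent hz f‖ ^ 2 := by
  rw [← Lp.inner_fourier_eq, ← Lp.norm_fourier_eq (freeResolvent hz f), L2.inner_def,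
    ← RCLike.im_eq_complex_im, ← integral_im (L2.integrable_inner _ _),
    ← inner_self_eq_norm_sq (𝕜 := ℂ), L2.inner_def, ← integral_re (L2.integrable_inner _ _),
    ← integral_const_mul]
  refine integral_congr_ae ?_
  rw [fourier_freeResolvent]
  filter_upwards [coeFn_mulOp (memLp_inv_helmholtzSymbol hz) (𝓕 f)] with ξ h1
  have hf : (𝓕 f : Lp ℂ 2 volume) ξ = helmholtzSymbol z ξ *
      (mulOp (memLp_inv_helmholtzSymbol hz) (𝓕 f)) ξ := by
    rw [h1, mul_inv_cancel_left₀ (helmholtzSymbol_ne_zero hz ξ)]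
  have hp : (helmholtzSymbol z ξ).im = -z.im := by
    rw [helmholtzSymbol, Complex.sub_im, Complex.ofReal_im, zero_sub]
  rw [hf]
  simp only [RCLike.inner_apply, map_mul, RCLike.mul_conj]
  generalize (mulOp (memLp_inv_helmholtzSymbol hz) (𝓕 f)) ξ = c
  rw [mul_left_comm, RCLike.mul_conj]
  simp [hp, ← Complex.ofReal_pow]

end Resolvent

/-! ### A variational eigenvector for real-linear symmetric compact maps. -/

section Maximizer

variable {H : Type*} [NormedAddCommGroup H] [InnerProductSpace ℂ H] [CompleteSpace H]
  [TopologicalSpace.SeparableSpace H]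

theorem exists_subseq_tendsto_weakly {u : ℕ → H} (hu : ∀ n, ‖u n‖ ≤ 1) :
    ∃ (f : H) (φ : ℕ → ℕ), ‖f‖ ≤ 1 ∧ StrictMono φ ∧
      ∀ g : H, Tendsto (fun n => ⟪u (φ n), g⟫_ℂ) atTop (𝓝 ⟪f, g⟫_ℂ) := by
  have hmem : ∀ n, StrongDual.toWeakDual (InnerProductSpace.toDual ℂ H (u n)) ∈
      WeakDual.toStrongDual ⁻¹' Metric.closedBall (0 : StrongDual ℂ H) 1 := fun n => by
    simpa using hu n
  obtain ⟨l, hl, φ, hφ, ht⟩ := WeakDual.isSeqCompact_closedBall ℂ H (0 : StrongDual ℂ H) 1 hmem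
  refine ⟨(InnerProductSpace.toDual ℂ H).symm (WeakDual.toStrongDual l), φ, ?_, hφ, fun g => ?_⟩
  · simpa using hl
  · have := (WeakDual.eval_continuous g).continuousAt.tendsto.comp ht
    simpa [Function.comp_def] using this

/-- `A` is only real-linear because it will be applied to an antilinear map. Compactness enters as
weak-to-strong continuity, which lets the supremum of the Rayleigh quotient be attained; `h` keeps
that supremum above `c`. -/
theorem exists_eigenvector_of_symmetric (A : H →L[ℝ] H)
    (hsymm : ∀ f g : H, (⟪A f, g⟫_ℂ).re = (⟪f, A g⟫_ℂ).re)
    (hcpt : ∀ (u : ℕ → H) (f : H), (∀ n, ‖u n‖ ≤ 1) →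
      (∀ g, Tendsto (fun n => ⟪u n, g⟫_ℂ) atTop (𝓝 ⟪f, g⟫_ℂ)) →
      Tendsto (fun n => A (u n)) atTop (𝓝 (A f)))
    {h : H} (h0 : h ≠ 0) {c : ℝ} (hc : 0 < c) (hh : c * ‖h‖ ^ 2 ≤ (⟪A h, h⟫_ℂ).re) :
    ∃ s : ℝ, c ≤ s ∧ ∃ f : H, f ≠ 0 ∧ A f = (s : ℂ) • f := by
  set q : H → ℝ := fun x => (⟪A x, x⟫_ℂ).re with hq
  have hl : ∀ (t : ℝ) (x y : H), (⟪t • x, y⟫_ℂ).re = t * (⟪x, y⟫_ℂ).re := fun t x y => by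
    rw [← Complex.coe_smul, inner_smul_left, Complex.conj_ofReal, Complex.re_ofReal_mul]
  have hr : ∀ (t : ℝ) (x y : H), (⟪x, t • y⟫_ℂ).re = t * (⟪x, y⟫_ℂ).re := fun t x y => by
    rw [← Complex.coe_smul, inner_smul_right, Complex.re_ofReal_mul]
  have hqsmul : ∀ (t : ℝ) (x : H), q (t • x) = t ^ 2 * q x := fun t x => by
    simp only [hq, map_smul, hl, hr]
    ring
  have hqle : ∀ x, q x ≤ ‖A‖ * ‖x‖ ^ 2 := fun x => by
    calc q x ≤ ‖⟪A x, x⟫_ℂ‖ := Complex.re_le_norm _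
      _ ≤ ‖A x‖ * ‖x‖ := norm_inner_le_norm _ _
      _ ≤ (‖A‖ * ‖x‖) * ‖x‖ := by gcongr; exact A.le_opNorm x
      _ = _ := by ring
  set K : Set ℝ := q '' Metric.closedBall 0 1 with hK
  have hKne : K.Nonempty := ⟨q 0, 0, by simp, rfl⟩
  have hKb : BddAbove K := by
    refine ⟨‖A‖, ?_⟩
    rintro _ ⟨x, hx, rfl⟩
    have hx1 : ‖x‖ ≤ 1 := by simpa using hx
    calc q x ≤ ‖A‖ * ‖x‖ ^ 2 := hqle x
      _ ≤ ‖A‖ * 1 := by gcongr; exact pow_le_one₀ (norm_nonneg _) hx1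
      _ = ‖A‖ := mul_one _
  set s := sSup K with hs
  have hle : ∀ x, q x ≤ s * ‖x‖ ^ 2 := fun x => by
    rcases eq_or_ne x 0 with rfl | hx
    · simp [hq]
    have hx' : 0 < ‖x‖ := norm_pos_iff.mpr hx
    have h1 : q (‖x‖⁻¹ • x) ≤ s := le_csSup hKb ⟨_, by
      simp [norm_smul, inv_mul_cancel₀ hx'.ne'], rfl⟩
    rw [hqsmul, inv_pow, inv_mul_le_iff₀ (by positivity)] at h1
    linarith
  have hcs : c ≤ s := by
    have h2 : 0 < ‖h‖ ^ 2 := by positivity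
    exact le_of_mul_le_mul_right (hh.trans (hle h)) h2
  obtain ⟨v, -, hvt, hvm⟩ := exists_seq_tendsto_sSup hKne hKb
  choose u hu huq using hvm
  have hu1 : ∀ n, ‖u n‖ ≤ 1 := fun n => by simpa using hu n
  obtain ⟨f, φ, hf1, hφ, hw⟩ := exists_subseq_tendsto_weakly hu1
  have hA := hcpt (u ∘ φ) f (fun n => hu1 _) hw
  have hqf : q f = s := by
    have h1 : Tendsto (fun n => q (u (φ n))) atTop (𝓝 s) := by
      simpa [huq, Function.comp_def] using hvt.comp hφ.tendsto_atTop
    have h2 : Tendsto (fun n => q (u (φ n))) atTop (𝓝 (q f)) := by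
      -- The `u (φ n)` converge only weakly, but strong convergence of `A (u (φ n))` lets the
      -- quadratic form pass to the limit.
      have h3 : Tendsto (fun n => ⟪A (u (φ n)) - A f, u (φ n)⟫_ℂ) atTop (𝓝 0) := by
        refine squeeze_zero_norm (a := fun n => ‖A (u (φ n)) - A f‖) (fun n => ?_) ?_
        · exact (norm_inner_le_norm _ _).trans
            (mul_le_of_le_one_right (norm_nonneg _) (hu1 _))
        · simpa using (hA.sub_const (A f)).norm
      have h4 : Tendsto (fun n => ⟪A f, u (φ n)⟫_ℂ) atTop (𝓝 ⟪A f, f⟫_ℂ) := by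
        have := (Complex.continuous_conj.tendsto _).comp (hw (A f))
        simpa [Function.comp_def] using this
      have h5 := (Complex.continuous_re.tendsto _).comp (h3.add h4)
      refine (h5.congr fun n => ?_).trans_eq ?_
      · simp [hq]
      · simp [hq]
    exact tendsto_nhds_unique h2 h1
  have hspos : 0 < s := hc.trans_le hcs
  have hf0 : f ≠ 0 := by
    rintro rfl
    simp [hq] at hqf
    exact hspos.ne hqf
  have hfn : ‖f‖ ^ 2 = 1 := by
    have h1 := hle f
    rw [hqf] at h1
    have h2 : ‖f‖ ^ 2 ≤ 1 := pow_le_one₀ (norm_nonneg _) hf1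
    nlinarith
  refine ⟨s, hcs, f, hf0, ?_⟩
  set g := A f - s • f with hg
  -- Maximality at `f + t • g`, where `g` is the residual `A f - s f`: the term linear in `t` is
  -- exactly `2 t ‖g‖²`.
  have hexp : ∀ t : ℝ, 2 * t * ‖g‖ ^ 2 ≤ t ^ 2 * (s * ‖g‖ ^ 2 - q g) := fun t => by
    have h1 := hle (f + t • g)
    have h2 : q (f + t • g) = q f + 2 * t * (⟪A f, g⟫_ℂ).re + t ^ 2 * q g := by
      have h3 := hsymm g f
      have h4 : (⟪g, A f⟫_ℂ).re = (⟪A f, g⟫_ℂ).re := by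
        rw [← inner_conj_symm, Complex.conj_re]
      simp only [hq, map_add, map_smul, hl, hr, inner_add_left, inner_add_right, Complex.add_re]
      rw [h3, h4]
      ring
    have h5 : ‖f + t • g‖ ^ 2 = ‖f‖ ^ 2 + 2 * t * (⟪f, g⟫_ℂ).re + t ^ 2 * ‖g‖ ^ 2 := by
      rw [@norm_add_sq ℂ, ← Complex.coe_smul, inner_smul_right, norm_smul]
      simp only [RCLike.re_eq_complex_re, Complex.re_ofReal_mul, mul_pow, Complex.norm_real,
        Real.norm_eq_abs, sq_abs]
      ring
    have h6 : ‖g‖ ^ 2 = (⟪A f, g⟫_ℂ).re - s * (⟪f, g⟫_ℂ).re := by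
      rw [← inner_self_eq_norm_sq (𝕜 := ℂ)]
      conv_lhs => rw [hg]
      rw [← hg, inner_sub_left, ← Complex.coe_smul, inner_smul_left]
      simp
    rw [h2, h5, hqf, hfn] at h1
    linear_combination h1 + 2 * t * h6
  have hg0 : ‖g‖ ^ 2 = 0 := by
    by_contra hne
    have hpos : 0 < ‖g‖ ^ 2 := lt_of_le_of_ne (by positivity) (Ne.symm hne)
    set B := s * ‖g‖ ^ 2 - q g with hB
    have hB0 : 0 ≤ B := sub_nonneg.mpr (hle g)
    -- This `t` is small enough for the linear term to win; the `+ 1` covers `B = 0`.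
    have h1 := hexp (‖g‖ ^ 2 / (B + 1))
    have h2 : 0 < B + 1 := by linarith
    rw [div_pow, mul_assoc, div_mul_eq_mul_div, div_mul_eq_mul_div, ← mul_div_assoc,
      div_le_div_iff₀ h2 (by positivity)] at h1
    have h3 : 0 < (‖g‖ ^ 2) ^ 2 * (B + 1) := by positivity
    nlinarith
  rw [Complex.coe_smul]
  exact sub_eq_zero.mp (by simpa [hg] using hg0)

end Maximizer

/-! ### Compactness of the resolvent after cut-off to a set of finite measure. -/

section Compactness

theorem norm_sq_eq_integral {α : Type*} [MeasurableSpace α] {μ : Measure α} (f : Lp ℂ 2 μ) :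
    ‖f‖ ^ 2 = ∫ x, ‖f x‖ ^ 2 ∂μ := by
  rw [← inner_self_eq_norm_sq (𝕜 := ℂ), L2.inner_def, ← integral_re (L2.integrable_inner _ _)]
  exact integral_congr_ae (ae_of_all _ fun x => inner_self_eq_norm_sq (𝕜 := ℂ) _)

theorem integrable_norm_sq_coeFn {α : Type*} [MeasurableSpace α] {μ : Measure α}
    (f : Lp ℂ 2 μ) : Integrable (fun x => ‖f x‖ ^ 2) μ :=
  (memLp_two_iff_integrable_sq_norm (Lp.aestronglyMeasurable f)).mp (Lp.memLp f)

theorem memLp_indicator_one {α : Type*} [MeasurableSpace α] (μ : Measure α) {T : Set α}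
    (hT : MeasurableSet T) : MemLp (T.indicator fun _ => (1 : ℂ)) ∞ μ :=
  (memLp_top_const 1).indicator hT

variable {E : Type*} [NormedAddCommGroup E] [InnerProductSpace ℝ E] [FiniteDimensional ℝ E]
  [MeasurableSpace E] [BorelSpace E]

theorem fourier_coeFn_of_integrable (f : Lp ℂ 2 (volume : Measure E)) (hf : Integrable f) :
    (𝓕 f : Lp ℂ 2 (volume : Measure E)) =ᵐ[volume]
      fun ξ => ∫ x, Real.fourierChar (-⟪x, ξ⟫_ℝ) • f x := by
  have hcont : Continuous (𝓕 (f : E → ℂ)) :=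
    VectorFourier.fourierIntegral_continuous Real.continuous_fourierChar
      (by exact continuous_inner) hf
  refine ae_eq_of_integral_contDiff_smul_eq ((Lp.memLp (𝓕 f)).locallyIntegrable (by norm_num))
    (f' := 𝓕 (f : E → ℂ)) hcont.locallyIntegrable fun g g_smooth g_cpt => ?_
  have hg₁ : HasCompactSupport (Complex.ofRealCLM ∘ g) := g_cpt.comp_left rfl
  have hg₂ : ContDiff ℝ (⊤ : ℕ∞) (Complex.ofRealCLM ∘ g) :=
    Complex.ofRealCLM.contDiff.comp g_smooth
  set φ : 𝓢(E, ℂ) := hg₁.toSchwartzMap hg₂ with hφ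
  have h1 := DFunLike.congr_fun (Lp.fourier_toTemperedDistribution_eq f) φ
  rw [TemperedDistribution.fourier_apply, Lp.toTemperedDistribution_apply,
    Lp.toTemperedDistribution_apply] at h1
  have h2 : ∫ ξ, 𝓕 φ ξ • f ξ = ∫ x, φ x • 𝓕 (f : E → ℂ) x := by
    simpa using! VectorFourier.integral_fourierIntegral_smul_eq_flip (L := innerₗ E)
      Real.continuous_fourierChar continuous_inner φ.integrable hf
  rw [h2] at h1
  exact h1.symm

omit [FiniteDimensional ℝ E] [MeasurableSpace E] [BorelSpace E] in
theorem norm_indicator_conj_fourierChar_le (T : Set E) (ξ x : E) :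
    ‖T.indicator (fun x => starRingEnd ℂ (Real.fourierChar (-⟪x, ξ⟫_ℝ) : ℂ)) x‖ ≤
      ‖T.indicator (fun _ => (1 : ℂ)) x‖ := by
  by_cases hx : x ∈ T
  · rw [Set.indicator_of_mem hx, Set.indicator_of_mem hx, RCLike.norm_conj, norm_one]
    exact (Circle.norm_coe _).le
  · simp [hx]

theorem memLp_indicator_conj_fourierChar {T : Set E} (hT : MeasurableSet T)
    (hfin : volume T ≠ ∞) (ξ : E) :
    MemLp (T.indicator fun x => starRingEnd ℂ (Real.fourierChar (-⟪x, ξ⟫_ℝ) : ℂ)) 2 volume :=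
  (memLp_indicator_const 2 hT (1 : ℂ) (Or.inr hfin)).mono
    ((Continuous.aestronglyMeasurable (by fun_prop)).indicator hT)
    (ae_of_all _ (norm_indicator_conj_fourierChar_le T ξ))

/-- The conjugate character of frequency `ξ`, cut off to `T`. -/
def cutoffChar {T : Set E} (hT : MeasurableSet T) (hfin : volume T ≠ ∞) (ξ : E) :
    Lp ℂ 2 (volume : Measure E) :=
  (memLp_indicator_conj_fourierChar hT hfin ξ).toLp _

theorem norm_cutoffChar_le {T : Set E} (hT : MeasurableSet T) (hfin : volume T ≠ ∞) (ξ : E) :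
    ‖cutoffChar hT hfin ξ‖ ≤ ‖indicatorConstLp 2 hT hfin (1 : ℂ)‖ := by
  refine Lp.norm_le_norm_of_ae_le ?_
  filter_upwards [(memLp_indicator_conj_fourierChar hT hfin ξ).coeFn_toLp,
    indicatorConstLp_coeFn (p := 2) (hs := hT) (hμs := hfin) (c := (1 : ℂ))] with x h1 h2
  rw [h2, cutoffChar, h1]
  exact norm_indicator_conj_fourierChar_le T ξ x

/-- Each frequency value is a pairing with a fixed `L²` vector, so weak convergence of `f` becomes
pointwise convergence in `ξ`. -/
theorem fourier_mulOp_indicator {T : Set E} (hT : MeasurableSet T) (hfin : volume T ≠ ∞)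
    (f : Lp ℂ 2 (volume : Measure E)) :
    (𝓕 (mulOp (memLp_indicator_one volume hT) f) : Lp ℂ 2 (volume : Measure E)) =ᵐ[volume]
      fun ξ => ⟪cutoffChar hT hfin ξ, f⟫_ℂ := by
  have hP := coeFn_mulOp (memLp_indicator_one volume hT) f
  have hP' : mulOp (memLp_indicator_one volume hT) f =ᵐ[volume] T.indicator f := by
    filter_upwards [hP] with x hx
    rw [hx]
    by_cases hx : x ∈ T <;> simp [hx]
  have hint : Integrable (mulOp (memLp_indicator_one volume hT) f) := by
    refine Integrable.congr ?_ hP'.symm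
    rw [integrable_indicator_iff hT]
    have : IsFiniteMeasure (volume.restrict T) := ⟨by simpa using hfin.lt_top⟩
    exact ((Lp.memLp f).restrict T).integrable (by norm_num)
  filter_upwards [fourier_coeFn_of_integrable _ hint] with ξ hξ
  rw [hξ, L2.inner_def]
  refine integral_congr_ae ?_
  filter_upwards [hP', (memLp_indicator_conj_fourierChar hT hfin ξ).coeFn_toLp] with x h1 h2
  rw [h1, cutoffChar, h2]
  by_cases hx : x ∈ T <;> simp [hx, Circle.smul_def, mul_comm]

omit [InnerProductSpace ℝ E] [FiniteDimensional ℝ E] [MeasurableSpace E] [BorelSpace E] in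
theorem exists_forall_norm_inv_helmholtzSymbol_le (z : ℂ) {δ : ℝ} (hδ : 0 < δ) :
    ∃ r : ℝ, ∀ ξ : E, r < ‖ξ‖ → ‖(helmholtzSymbol z ξ)⁻¹‖ ≤ δ := by
  refine ⟨max 1 (‖z‖ + δ⁻¹), fun ξ hξ => ?_⟩
  have h1 : 1 < ‖ξ‖ := (le_max_left _ _).trans_lt hξ
  have h2 : ‖z‖ + δ⁻¹ < ‖ξ‖ := (le_max_right _ _).trans_lt hξ
  have h3 : ‖ξ‖ ≤ (2 * Real.pi) ^ 2 * ‖ξ‖ ^ 2 := by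
    have := Real.pi_gt_three
    have h4 : 1 ≤ (2 * Real.pi) ^ 2 := by nlinarith
    nlinarith
  have h5 : δ⁻¹ ≤ ‖helmholtzSymbol z ξ‖ := by
    have h6 := norm_sub_norm_le (((2 * Real.pi) ^ 2 * ‖ξ‖ ^ 2 : ℝ) : ℂ) z
    rw [Complex.norm_real, Real.norm_of_nonneg (by positivity)] at h6
    rw [helmholtzSymbol]
    linarith
  rw [norm_inv]
  exact inv_le_of_inv_le₀ hδ h5

/-- Split frequency space at a large radius. Inside the ball dominated convergence applies, with a
bound uniform in `ξ`; outside, the inverse symbol is at most `δ`. -/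
theorem tendsto_freeResolvent_mulOp_of_weakly_null {z : ℂ} (hz : z.im ≠ 0) {T : Set E}
    (hT : MeasurableSet T) (hfin : volume T ≠ ∞) {w : ℕ → Lp ℂ 2 (volume : Measure E)} {M : ℝ}
    (hM : ∀ n, ‖w n‖ ≤ M) (hw : ∀ g, Tendsto (fun n => ⟪g, w n⟫_ℂ) atTop (𝓝 0)) :
    Tendsto (fun n => freeResolvent hz (mulOp (memLp_indicator_one volume hT) (w n)))
      atTop (𝓝 0) := by
  set v := fun n => mulOp (memLp_indicator_one volume hT) (w n) with hv
  set a := fun n ξ => ⟪cutoffChar hT hfin ξ, w n⟫_ℂ with ha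
  have hva : ∀ n, (𝓕 (v n) : Lp ℂ 2 (volume : Measure E)) =ᵐ[volume] a n := fun n =>
    fourier_mulOp_indicator hT hfin (w n)
  have hM0 : 0 ≤ M := (norm_nonneg _).trans (hM 0)
  set C := ‖indicatorConstLp 2 hT hfin (1 : ℂ)‖ * M with hC
  have haC : ∀ n ξ, ‖a n ξ‖ ≤ C := fun n ξ =>
    (norm_inner_le_norm _ _).trans
      (mul_le_mul (norm_cutoffChar_le hT hfin ξ) (hM n) (norm_nonneg _) (norm_nonneg _))
  set N := ‖mulOp (memLp_indicator_one (volume : Measure E) hT)‖ * M with hN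
  have hvN : ∀ n, ‖v n‖ ≤ N := fun n =>
    (ContinuousLinearMap.le_opNorm _ _).trans
      (mul_le_mul_of_nonneg_left (hM n) (norm_nonneg _))
  have hsq : Tendsto (fun n => ‖freeResolvent hz (v n)‖ ^ 2) atTop (𝓝 0) := by
    rw [Metric.tendsto_atTop]
    intro η hη
    obtain ⟨δ, hδ, hδη⟩ : ∃ δ : ℝ, 0 < δ ∧ δ ^ 2 * N ^ 2 < η / 2 := by
      refine ⟨√(η / 4 / (N ^ 2 + 1)), by positivity, ?_⟩
      rw [Real.sq_sqrt (by positivity), div_mul_eq_mul_div, div_lt_iff₀ (by positivity)]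
      nlinarith [sq_nonneg N]
    obtain ⟨r, hr⟩ := exists_forall_norm_inv_helmholtzSymbol_le (E := E) z hδ
    have hball : Tendsto (fun n => ∫ ξ in Metric.closedBall (0 : E) r,
        (|z.im|⁻¹) ^ 2 * ‖a n ξ‖ ^ 2) atTop (𝓝 0) := by
      have h0 : (0 : ℝ) = ∫ ξ in Metric.closedBall (0 : E) r, (0 : ℝ) := by simp
      rw [h0]
      have : IsFiniteMeasure (volume.restrict (Metric.closedBall (0 : E) r)) :=
        ⟨by simpa using measure_closedBall_lt_top⟩
      refine tendsto_integral_of_dominated_convergence (fun _ => (|z.im|⁻¹) ^ 2 * C ^ 2)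
        (fun n => ?_) (integrable_const _) (fun n => ae_of_all _ fun ξ => ?_)
        (ae_of_all _ fun ξ => ?_)
      · have h1 : AEStronglyMeasurable (a n) volume :=
          (Lp.aestronglyMeasurable _).congr (hva n)
        exact ((h1.norm.pow 2).const_mul _).restrict
      · rw [Real.norm_of_nonneg (by positivity)]
        gcongr
        exact haC n ξ
      · have h1 := ((hw (cutoffChar hT hfin ξ)).norm.pow 2).const_mul ((|z.im|⁻¹) ^ 2)
        simpa using h1
    obtain ⟨n₀, hn₀⟩ := (Metric.tendsto_atTop.mp hball) (η / 2) (by positivity)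
    refine ⟨n₀, fun n hn => ?_⟩
    have h1 := hn₀ n hn
    rw [Real.dist_eq, sub_zero, abs_of_nonneg (by positivity)]
    rw [Real.dist_eq, sub_zero] at h1
    have hbi : Integrable (fun ξ => (Metric.closedBall (0 : E) r).indicator
        (fun ξ => (|z.im|⁻¹) ^ 2 * ‖a n ξ‖ ^ 2) ξ) volume := by
      refine Integrable.indicator ?_ Metric.isClosed_closedBall.measurableSet
      refine Integrable.const_mul ?_ _
      refine (integrable_norm_sq_coeFn (𝓕 (v n))).congr ?_
      filter_upwards [hva n] with ξ h
      rw [h]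
    have hti := (integrable_norm_sq_coeFn (𝓕 (v n))).const_mul (δ ^ 2)
    calc ‖freeResolvent hz (v n)‖ ^ 2
        = ∫ ξ, ‖(𝓕 (freeResolvent hz (v n)) : Lp ℂ 2 (volume : Measure E)) ξ‖ ^ 2 := by
          rw [← Lp.norm_fourier_eq, norm_sq_eq_integral]
      _ ≤ ∫ ξ, ((Metric.closedBall (0 : E) r).indicator
            (fun ξ => (|z.im|⁻¹) ^ 2 * ‖a n ξ‖ ^ 2) ξ +
              δ ^ 2 * ‖(𝓕 (v n) : Lp ℂ 2 (volume : Measure E)) ξ‖ ^ 2) := by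
          refine integral_mono_ae (integrable_norm_sq_coeFn _) (hbi.add hti) ?_
          rw [fourier_freeResolvent]
          filter_upwards [coeFn_mulOp (memLp_inv_helmholtzSymbol hz) (𝓕 (v n)), hva n]
            with ξ h2 h3
          rw [h2, norm_mul, mul_pow]
          by_cases hξ : ξ ∈ Metric.closedBall (0 : E) r
          · rw [Set.indicator_of_mem hξ, h3]
            refine le_add_of_le_of_nonneg ?_ (by positivity)
            gcongr
            rw [norm_inv]
            exact inv_anti₀ (abs_pos.mpr hz) (im_le_norm_helmholtzSymbol z ξ)
          · rw [Set.indicator_of_notMem hξ, zero_add]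
            gcongr
            exact hr ξ (by simpa using hξ)
      _ = (∫ ξ in Metric.closedBall (0 : E) r, (|z.im|⁻¹) ^ 2 * ‖a n ξ‖ ^ 2) +
            δ ^ 2 * ‖v n‖ ^ 2 := by
          rw [integral_add hbi hti, integral_indicator Metric.isClosed_closedBall.measurableSet,
            integral_const_mul (δ ^ 2), ← norm_sq_eq_integral, Lp.norm_fourier_eq]
      _ < η := by
          have h4 := (abs_lt.mp h1).2
          have h5 : δ ^ 2 * ‖v n‖ ^ 2 ≤ δ ^ 2 * N ^ 2 := by gcongr; exact hvN n
          linarith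
  rw [tendsto_zero_iff_norm_tendsto_zero]
  have := hsq.sqrt
  simpa using this

end Compactness

/-! ### The Birman–Schwinger operator and the potential. -/

section Potential

variable {E : Type*} [NormedAddCommGroup E] [InnerProductSpace ℝ E] [FiniteDimensional ℝ E]
  [MeasurableSpace E] [BorelSpace E]

/-- The Birman–Schwinger operator `-i χ_T (-Δ - z)⁻¹ χ_T`. -/
def birmanSchwinger {z : ℂ} (hz : z.im ≠ 0) {T : Set E} (hT : MeasurableSet T) :
    Lp ℂ 2 (volume : Measure E) →L[ℂ] Lp ℂ 2 (volume : Measure E) :=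
  (-Complex.I) • (mulOp (memLp_indicator_one volume hT) ∘L freeResolvent hz ∘L
    mulOp (memLp_indicator_one volume hT))

theorem birmanSchwinger_apply {z : ℂ} (hz : z.im ≠ 0) {T : Set E} (hT : MeasurableSet T)
    (f : Lp ℂ 2 (volume : Measure E)) :
    birmanSchwinger hz hT f = (-Complex.I) • mulOp (memLp_indicator_one volume hT)
      (freeResolvent hz (mulOp (memLp_indicator_one volume hT) f)) := rfl

theorem inner_conjOp_birmanSchwinger {z : ℂ} (hz : z.im ≠ 0) {T : Set E} (hT : MeasurableSet T)
    (f g : Lp ℂ 2 (volume : Measure E)) :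
    ⟪conjOp volume (birmanSchwinger hz hT f), g⟫_ℂ =
      ⟪conjOp volume f, birmanSchwinger hz hT g⟫_ℂ := by
  rw [inner_conjOp_comm, birmanSchwinger_apply, birmanSchwinger_apply, inner_smul_right,
    inner_smul_right, inner_conjOp_comm g, inner_conjOp_mulOp, inner_conjOp_freeResolvent,
    inner_conjOp_mulOp]

theorem mulOp_indicator_eq_self {T : Set E} (hT : MeasurableSet T)
    {f : Lp ℂ 2 (volume : Measure E)} (hf : ∀ᵐ x, x ∉ T → f x = 0) :
    mulOp (memLp_indicator_one volume hT) f = f := by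
  refine Lp.ext ?_
  filter_upwards [coeFn_mulOp (memLp_indicator_one volume hT) f, hf] with x h1 h2
  rw [h1]
  by_cases hx : x ∈ T
  · simp [hx]
  · simp [hx, h2 hx]

/-- Duality: `‖h‖² = ∫ (R h) (-Δ - z) h` for real `h`, then Cauchy–Schwarz. -/
theorem norm_toLp_le_mul_norm_freeResolvent {z : ℂ} (hz : z.im ≠ 0) {h : 𝓢(E, ℂ)}
    (hcu : conjOp volume (h.toLp 2 volume) = h.toLp 2 volume) {K : ℝ}
    (hhK : ‖(-Δ h - z • h).toLp 2 volume‖ ≤ K * ‖h.toLp 2 volume‖) :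
    ‖h.toLp 2 volume‖ ≤ K * ‖freeResolvent hz (h.toLp 2 volume)‖ := by
  rcases eq_or_ne (h.toLp 2 volume) 0 with h0 | h0
  · simp [h0]
  have hpos : 0 < ‖h.toLp 2 volume‖ := norm_pos_iff.mpr h0
  have h1 : ‖h.toLp 2 volume‖ ^ 2 = ‖⟪conjOp volume (freeResolvent hz (h.toLp 2 volume)),
      (-Δ h - z • h).toLp 2 volume⟫_ℂ‖ := by
    rw [inner_conjOp_freeResolvent_helmholtz, hcu, inner_self_eq_norm_sq_to_K, norm_pow]
    simp
  have h2 : ‖h.toLp 2 volume‖ ^ 2 ≤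
      ‖freeResolvent hz (h.toLp 2 volume)‖ * (K * ‖h.toLp 2 volume‖) := by
    rw [h1]
    refine (norm_inner_le_norm _ _).trans ?_
    rw [norm_conjOp]
    exact mul_le_mul_of_nonneg_left hhK (norm_nonneg _)
  refine le_of_mul_le_mul_right ?_ hpos
  calc _ = ‖h.toLp 2 volume‖ ^ 2 := (sq _).symm
    _ ≤ _ := h2
    _ = _ := by ring

/-- For real `u` the bilinear and sesquilinear forms coincide, and the factor `-i` turns the
imaginary part of the resolvent form into a real part. -/
theorem re_inner_conjOp_birmanSchwinger {z : ℂ} (hz : z.im ≠ 0) {T : Set E}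
    (hT : MeasurableSet T) {u : Lp ℂ 2 (volume : Measure E)} (hcu : conjOp volume u = u)
    (hPu : mulOp (memLp_indicator_one volume hT) u = u) :
    (⟪conjOp volume (birmanSchwinger hz hT u), u⟫_ℂ).re =
      z.im * ‖freeResolvent hz u‖ ^ 2 := by
  rw [inner_conjOp_birmanSchwinger, birmanSchwinger_apply, hPu, inner_smul_right,
    ← inner_conjOp_mulOp, hPu, hcu, ← im_inner_freeResolvent hz u]
  simp

theorem tendsto_birmanSchwinger {z : ℂ} (hz : z.im ≠ 0) {T : Set E}
    (hT : MeasurableSet T) (hfin : volume T ≠ ∞) {v : ℕ → Lp ℂ 2 (volume : Measure E)}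
    {f : Lp ℂ 2 (volume : Measure E)} (hv : ∀ n, ‖v n‖ ≤ 1)
    (hw : ∀ g, Tendsto (fun n => ⟪v n, g⟫_ℂ) atTop (𝓝 ⟪f, g⟫_ℂ)) :
    Tendsto (fun n => birmanSchwinger hz hT (v n)) atTop (𝓝 (birmanSchwinger hz hT f)) := by
  have h1 := tendsto_freeResolvent_mulOp_of_weakly_null hz hT hfin
    (w := fun n => v n - f) (M := 1 + ‖f‖)
    (fun n => (norm_sub_le _ _).trans (add_le_add_left (hv n) _)) (fun g => by
      have h2 := (Complex.continuous_conj.tendsto _).comp (hw g)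
      have h3 := h2.sub_const ⟪g, f⟫_ℂ
      simpa [Function.comp_def, inner_sub_right] using h3)
  have h2 := ((mulOp (memLp_indicator_one volume hT)).continuous.tendsto 0).comp h1
  have h3 := h2.const_smul (-Complex.I)
  rw [← tendsto_sub_nhds_zero_iff]
  rw [map_zero, smul_zero] at h3
  refine h3.congr fun n => ?_
  rw [← map_sub]
  rfl

theorem exists_conjOp_eigenvector {z : ℂ} (hz : 0 < z.im) {T : Set E} (hT : MeasurableSet T)
    (hfin : volume T ≠ ∞) {h : 𝓢(E, ℂ)} (hreal : ∀ x, starRingEnd ℂ (h x) = h x)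
    (hsupp : ∀ x, x ∉ T → h x = 0) (h0 : h.toLp 2 volume ≠ 0) {K : ℝ} (hK : 0 < K)
    (hhK : ‖(-Δ h - z • h).toLp 2 volume‖ ≤ K * ‖h.toLp 2 volume‖) :
    ∃ s : ℝ, z.im / K ^ 2 ≤ s ∧ ∃ f : Lp ℂ 2 (volume : Measure E), f ≠ 0 ∧
      birmanSchwinger hz.ne' hT f = (s : ℂ) • conjOp volume f := by
  have : Fact ((2 : ℝ≥0∞) ≠ ∞) := ⟨by norm_num⟩
  have hPu : mulOp (memLp_indicator_one volume hT) (h.toLp 2 volume) = h.toLp 2 volume := by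
    refine mulOp_indicator_eq_self hT ?_
    filter_upwards [h.coeFn_toLp 2 volume] with x hx hxT
    rw [hx, hsupp x hxT]
  have hcu : conjOp volume (h.toLp 2 volume) = h.toLp 2 volume := by
    refine Lp.ext ?_
    filter_upwards [coeFn_conjOp (h.toLp 2 volume), h.coeFn_toLp 2 volume] with x h1 h2
    rw [h1, h2, hreal]
  have hle := norm_toLp_le_mul_norm_freeResolvent hz.ne' hcu hhK
  have hq := re_inner_conjOp_birmanSchwinger hz.ne' hT hcu hPu
  generalize h.toLp 2 volume = u at *
  have hsymm : ∀ f g : Lp ℂ 2 (volume : Measure E),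
      (⟪conjOp volume (birmanSchwinger hz.ne' hT f), g⟫_ℂ).re =
        (⟪f, conjOp volume (birmanSchwinger hz.ne' hT g)⟫_ℂ).re := fun f g => by
    rw [← inner_conj_symm f, Complex.conj_re, inner_conjOp_birmanSchwinger,
      inner_conjOp_birmanSchwinger, inner_conjOp_comm f, inner_conjOp_birmanSchwinger]
  obtain ⟨s, hs, f, hf0, hf⟩ := exists_eigenvector_of_symmetric
    (conjOp volume ∘L (birmanSchwinger hz.ne' hT).restrictScalars ℝ) hsymm
    (fun v f hv hw => ((conjOp volume).continuous.tendsto _).comp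
      (tendsto_birmanSchwinger hz.ne' hT hfin hv hw))
    h0 (c := z.im / K ^ 2) (by positivity) (by
      refine le_trans ?_ hq.ge
      rw [div_mul_eq_mul_div, div_le_iff₀ (by positivity)]
      have : ‖u‖ ^ 2 ≤ (K * ‖freeResolvent hz.ne' u‖) ^ 2 :=
        pow_le_pow_left₀ (norm_nonneg _) hle 2
      nlinarith)
  refine ⟨s, hs, f, hf0, ?_⟩
  have hf' : conjOp volume (birmanSchwinger hz.ne' hT f) = (s : ℂ) • f := hf
  rw [← conjOp_conjOp (birmanSchwinger hz.ne' hT f), hf', conjOp_smul, Complex.conj_ofReal]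

end Potential

theorem exists_potential {d : ℕ} {z : ℂ} (hz : 0 < z.im) {T : Set (EuclideanSpace ℝ (Fin d))}
    (hT : MeasurableSet T) (hfin : volume T ≠ ∞) {h : 𝓢(EuclideanSpace ℝ (Fin d), ℂ)}
    (hreal : ∀ x, starRingEnd ℂ (h x) = h x)
    (hsupp : ∀ x, x ∉ T → h x = 0) (h0 : h.toLp 2 volume ≠ 0) {K : ℝ} (hK : 0 < K)
    (hhK : ‖(-Δ h - z • h).toLp 2 volume‖ ≤ K * ‖h.toLp 2 volume‖) :
    ∃ V : EuclideanSpace ℝ (Fin d) → ℂ, Measurable V ∧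
      (∀ x, ‖V x‖ ≤ K ^ 2 / z.im * T.indicator (fun _ => (1 : ℝ)) x) ∧
      IsSchrodingerEigenvalue V z := by
  obtain ⟨s, hs, f, hf0, hf⟩ := exists_conjOp_eigenvector hz hT hfin hreal hsupp h0 hK hhK
  have hspos : 0 < s := lt_of_lt_of_le (by positivity) hs
  rw [birmanSchwinger_apply] at hf
  have hae : ∀ᵐ x, -Complex.I * (T.indicator (fun _ => (1 : ℂ)) x *
      freeResolvent hz.ne' (mulOp (memLp_indicator_one volume hT) f) x) =
        s * starRingEnd ℂ (f x) := by
    set ψ := freeResolvent hz.ne' (mulOp (memLp_indicator_one volume hT) f)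
    filter_upwards [Lp.coeFn_smul (-Complex.I) (mulOp (memLp_indicator_one volume hT) ψ),
      Lp.coeFn_smul (s : ℂ) (conjOp volume f), coeFn_mulOp (memLp_indicator_one volume hT) ψ,
      coeFn_conjOp f] with x h1 h2 h3 h4
    rw [hf, h2, Pi.smul_apply, Pi.smul_apply, h3, h4] at h1
    simpa using h1.symm
  -- `f` inherits its support from `B f`, because `s ≠ 0`.
  have hPf : mulOp (memLp_indicator_one volume hT) f = f := by
    refine mulOp_indicator_eq_self hT ?_
    filter_upwards [hae] with x hx hxT
    simpa [hxT, hspos.ne'] using hx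
  rw [hPf] at hae
  set ψ := freeResolvent hz.ne' f with hψ
  -- Where `f` vanishes the quotient is `0` by the convention for division; this is harmless, as the
  -- equation asks only for `V ψ = -f = 0` there.
  refine ⟨T.indicator fun x => Complex.I * f x / (s * starRingEnd ℂ (f x)), ?_, fun x => ?_,
    ψ, ?_, -(f + z • ψ), laplacian_freeResolvent hz.ne' f, ?_⟩
  · have hm : Measurable f := (Lp.stronglyMeasurable f).measurable
    have hm' : Measurable fun x => starRingEnd ℂ (f x) :=
      Complex.continuous_conj.measurable.comp hm
    exact ((hm.const_mul _).div (hm'.const_mul _)).indicator hT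
  · have h1 : s⁻¹ ≤ K ^ 2 / z.im := by
      rw [← inv_div]
      exact inv_anti₀ (by positivity) hs
    by_cases hx : x ∈ T
    · simp only [Set.indicator_of_mem hx, mul_one]
      refine le_trans ?_ h1
      rcases eq_or_ne (f x) 0 with h2 | h2
      · simp [h2, hspos.le]
      · simp only [norm_div, norm_mul, Complex.norm_I, RCLike.norm_conj, Complex.norm_real,
          Real.norm_of_nonneg hspos.le]
        have : ‖f x‖ ≠ 0 := norm_ne_zero_iff.mpr h2
        refine le_of_eq ?_
        field_simp
    · simp [hx]
  · intro hψ0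
    rw [hPf, ← hψ, hψ0, map_zero, smul_zero] at hf
    rw [ne_eq, ← norm_eq_zero, ← norm_conjOp, norm_eq_zero] at hf0
    exact hf0 ((smul_eq_zero.mp hf.symm).resolve_left (by exact_mod_cast hspos.ne'))
  · filter_upwards [hae, Lp.coeFn_smul z ψ, Lp.coeFn_neg (f + z • ψ), Lp.coeFn_add f (z • ψ)]
      with x h1 h2 h3 h4
    rw [h3, Pi.neg_apply, h4, Pi.add_apply, h2, Pi.smul_apply, smul_eq_mul]
    by_cases hx : x ∈ T
    · rw [Set.indicator_of_mem hx] at h1 ⊢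
      rcases eq_or_ne (f x) 0 with h5 | h5
      · simp [h5]
      · have h6 : (s : ℂ) * starRingEnd ℂ (f x) ≠ 0 := by
          simpa [hspos.ne'] using h5
        rw [← h1, one_mul] at h6 ⊢
        have h7 : ψ x ≠ 0 := by
          rintro h8
          simp [h8] at h6
        field_simp
        ring
    · rw [Set.indicator_of_notMem hx] at h1 ⊢
      have h5 : f x = 0 := by simpa [hspos.ne'] using h1
      simp [h5]

/-! ### The quasimode: a standing wave in an anisotropic envelope. -/

section TestFunction

/-- The diagonal linear equivalence of `ℝᵈ` with nonzero entries `a`. -/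
def diagEquiv {d : ℕ} (a : Fin d → ℝ) (ha : ∀ i, a i ≠ 0) :
    EuclideanSpace ℝ (Fin d) ≃L[ℝ] EuclideanSpace ℝ (Fin d) :=
  (EuclideanSpace.equiv (Fin d) ℝ).trans <|
    (ContinuousLinearEquiv.piCongrRight fun i =>
      ContinuousLinearEquiv.unitsEquivAut ℝ (Units.mk0 (a i) (ha i))).trans
        (EuclideanSpace.equiv (Fin d) ℝ).symm

theorem diagEquiv_apply {d : ℕ} (a : Fin d → ℝ) (ha : ∀ i, a i ≠ 0)
    (x : EuclideanSpace ℝ (Fin d)) (i : Fin d) : diagEquiv a ha x i = a i * x i := by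
  simp [diagEquiv, mul_comm]

theorem diagEquiv_single {d : ℕ} (a : Fin d → ℝ) (ha : ∀ i, a i ≠ 0) (i : Fin d) :
    diagEquiv a ha (EuclideanSpace.single i 1) = a i • EuclideanSpace.single i (1 : ℝ) := by
  ext j
  rw [diagEquiv_apply]
  by_cases h : j = i
  · subst h; simp
  · simp [h]

theorem hasTemperateGrowth_cos : Function.HasTemperateGrowth Real.cos :=
  ⟨Real.contDiff_cos, fun n => ⟨0, 1, fun x => by
    rw [norm_iteratedFDeriv_eq_norm_iteratedDeriv]
    simpa using Real.abs_iteratedDeriv_cos_le_one n x⟩⟩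

variable {d : ℕ} [NeZero d]

/-- The plane standing wave `cos (x₁ + θ)`. -/
def standingWave (θ : ℝ) (x : EuclideanSpace ℝ (Fin d)) : ℂ := (Real.cos (x 0 + θ) : ℝ)

theorem hasTemperateGrowth_standingWave (θ : ℝ) :
    (standingWave θ : EuclideanSpace ℝ (Fin d) → ℂ).HasTemperateGrowth := by
  have h1 : (fun x : EuclideanSpace ℝ (Fin d) => x 0 + θ).HasTemperateGrowth :=
    ((EuclideanSpace.proj (𝕜 := ℝ) (0 : Fin d)).hasTemperateGrowth).add
      (Function.HasTemperateGrowth.const θ)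
  exact Function.HasTemperateGrowth.comp Function.Complex.hasTemperateGrowth_ofReal
    (hasTemperateGrowth_cos.comp h1)

/-- The wave packet `x ↦ cos (x₁ + θ) Φ (D x)`. -/
def wavePacket (D : EuclideanSpace ℝ (Fin d) ≃L[ℝ] EuclideanSpace ℝ (Fin d)) (θ : ℝ) :
    𝓢(EuclideanSpace ℝ (Fin d), ℂ) →L[ℂ] 𝓢(EuclideanSpace ℝ (Fin d), ℂ) :=
  SchwartzMap.smulLeftCLM ℂ (standingWave θ) ∘L SchwartzMap.compCLMOfContinuousLinearEquiv ℂ D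

variable (D : EuclideanSpace ℝ (Fin d) ≃L[ℝ] EuclideanSpace ℝ (Fin d))

theorem wavePacket_apply (θ : ℝ) (Φ : 𝓢(EuclideanSpace ℝ (Fin d), ℂ))
    (x : EuclideanSpace ℝ (Fin d)) :
    wavePacket D θ Φ x = (Real.cos (x 0 + θ) : ℝ) * Φ (D x) := by
  simp only [wavePacket, ContinuousLinearMap.comp_apply,
    SchwartzMap.smulLeftCLM_apply_apply (hasTemperateGrowth_standingWave θ),
    SchwartzMap.compCLMOfContinuousLinearEquiv_apply, Function.comp_apply, smul_eq_mul,
    standingWave]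

theorem wavePacket_add_pi_div_two_twice (θ : ℝ) (Φ : 𝓢(EuclideanSpace ℝ (Fin d), ℂ)) :
    wavePacket D (θ + Real.pi / 2 + Real.pi / 2) Φ = -wavePacket D θ Φ := by
  ext x
  rw [neg_apply, wavePacket_apply, wavePacket_apply,
    show x 0 + (θ + Real.pi / 2 + Real.pi / 2) = (x 0 + θ) + Real.pi by ring, Real.cos_add_pi]
  push_cast
  ring

open LineDeriv

/-- Since `cos' = cos (· + π/2)`, wave packets are closed under differentiation up to a phase shift.
-/
theorem lineDeriv_wavePacket (θ : ℝ) (Φ : 𝓢(EuclideanSpace ℝ (Fin d), ℂ))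
    (m : EuclideanSpace ℝ (Fin d)) :
    ∂_{m} (wavePacket D θ Φ) =
      (m 0 : ℂ) • wavePacket D (θ + Real.pi / 2) Φ + wavePacket D θ (∂_{D m} Φ) := by
  ext x
  rw [add_apply, smul_apply, wavePacket_apply, wavePacket_apply, SchwartzMap.lineDerivOp_apply,
    SchwartzMap.lineDerivOp_apply_eq_fderiv]
  refine HasLineDerivAt.lineDeriv ?_
  have h1 : HasDerivAt (fun t : ℝ => Φ (D x + t • D m)) (fderiv ℝ Φ (D x) (D m)) 0 :=
    (Φ.hasFDerivAt (D x)).hasLineDerivAt (D m)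
  have h2 : HasDerivAt (fun t : ℝ => Real.cos (x 0 + t * m 0 + θ))
      (-Real.sin (x 0 + 0 * m 0 + θ) * (1 * m 0)) 0 :=
    ((((hasDerivAt_id (0 : ℝ)).mul_const (m 0)).const_add (x 0)).add_const θ).cos
  have h3 := h2.ofReal_comp.mul h1
  have h4 : (fun t : ℝ => wavePacket D θ Φ (x + t • m)) =
      fun t : ℝ => ((Real.cos (x 0 + t * m 0 + θ) : ℝ) : ℂ) * Φ (D x + t • D m) := by
    funext t
    rw [wavePacket_apply, map_add, map_smul]
    rfl
  rw [HasLineDerivAt, h4]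
  refine h3.congr_deriv ?_
  rw [← add_assoc, Real.cos_add_pi_div_two]
  simp
  ring

theorem lineDeriv_lineDeriv_wavePacket (θ : ℝ) (Φ : 𝓢(EuclideanSpace ℝ (Fin d), ℂ))
    (m : EuclideanSpace ℝ (Fin d)) :
    ∂_{m} (∂_{m} (wavePacket D θ Φ)) =
      -((m 0 : ℂ) ^ 2 • wavePacket D θ Φ) +
        (2 * m 0 : ℂ) • wavePacket D (θ + Real.pi / 2) (∂_{D m} Φ) +
          wavePacket D θ (∂_{D m} (∂_{D m} Φ)) := by
  rw [lineDeriv_wavePacket, lineDerivOp_add, lineDerivOp_smul, lineDeriv_wavePacket,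
    lineDeriv_wavePacket, wavePacket_add_pi_div_two_twice]
  module

theorem laplacian_wavePacket {a : Fin d → ℝ} (ha : ∀ i, a i ≠ 0) (θ : ℝ)
    (Φ : 𝓢(EuclideanSpace ℝ (Fin d), ℂ)) :
    Δ (wavePacket (diagEquiv a ha) θ Φ) =
      -wavePacket (diagEquiv a ha) θ Φ +
        (2 * a 0 : ℂ) • wavePacket (diagEquiv a ha) (θ + Real.pi / 2)
          (∂_{EuclideanSpace.single (0 : Fin d) (1 : ℝ)} Φ) +
        ∑ i, ((a i : ℂ) ^ 2) • wavePacket (diagEquiv a ha) θ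
          (∂_{EuclideanSpace.single i (1 : ℝ)} (∂_{EuclideanSpace.single i (1 : ℝ)} Φ)) := by
  rw [SchwartzMap.laplacian_eq_sum (EuclideanSpace.basisFun (Fin d) ℝ)]
  simp only [EuclideanSpace.basisFun_apply, lineDeriv_lineDeriv_wavePacket, diagEquiv_single,
    lineDerivOp_left_smul, lineDerivOp_smul, Finset.sum_add_distrib]
  congr 1
  · congr 1
    · rw [Finset.sum_eq_single 0]
      · simp
      · intro i _ hi
        simp [hi.symm]
      · simp
    · rw [Finset.sum_eq_single 0]
      · simp only [← Complex.coe_smul, map_smul, smul_smul]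
        simp
      · intro i _ hi
        simp [hi.symm]
      · simp
  · refine Finset.sum_congr rfl fun i _ => ?_
    simp only [← Complex.coe_smul, map_smul, smul_smul, sq]

omit [NeZero d] in
theorem norm_toLp_sq (Ψ : 𝓢(EuclideanSpace ℝ (Fin d), ℂ)) :
    ‖Ψ.toLp 2 volume‖ ^ 2 = ∫ x, ‖Ψ x‖ ^ 2 := by
  rw [norm_sq_eq_integral]
  refine integral_congr_ae ?_
  filter_upwards [Ψ.coeFn_toLp 2 volume] with x hx
  rw [hx]

omit [NeZero d] in
theorem integrable_norm_sq (Ψ : 𝓢(EuclideanSpace ℝ (Fin d), ℂ)) :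
    Integrable fun x => ‖Ψ x‖ ^ 2 :=
  (memLp_two_iff_integrable_sq_norm Ψ.continuous.aestronglyMeasurable).mp (Ψ.memLp 2 volume)

omit [NeZero d] in
theorem exists_integral_comp_eq : ∃ κ : ℝ, 0 < κ ∧ ∀ F : EuclideanSpace ℝ (Fin d) → ℝ,
    ∫ x, F (D x) = κ ^ 2 * ∫ x, F x := by
  have hdet : LinearMap.det (D : EuclideanSpace ℝ (Fin d) →ₗ[ℝ] EuclideanSpace ℝ (Fin d)) ≠ 0 :=
    (LinearEquiv.isUnit_det' D.toLinearEquiv).ne_zero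
  have hmap := Measure.map_linearMap_addHaar_eq_smul_addHaar
    (volume : Measure (EuclideanSpace ℝ (Fin d))) hdet
  refine ⟨√|(LinearMap.det (D : EuclideanSpace ℝ (Fin d) →ₗ[ℝ] EuclideanSpace ℝ (Fin d)))⁻¹|,
    Real.sqrt_pos.mpr (abs_pos.mpr (inv_ne_zero hdet)), fun F => ?_⟩
  rw [Real.sq_sqrt (abs_nonneg _)]
  have h1 := (D.toHomeomorph.measurableEmbedding).integral_map (μ := volume) F
  have h2 : Measure.map D.toHomeomorph volume = ENNReal.ofReal
      |(LinearMap.det (D : EuclideanSpace ℝ (Fin d) →ₗ[ℝ] EuclideanSpace ℝ (Fin d)))⁻¹| •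
        (volume : Measure (EuclideanSpace ℝ (Fin d))) := hmap
  rw [h2, integral_smul_measure, ENNReal.toReal_ofReal (abs_nonneg _)] at h1
  exact h1.symm

/-- `κ²` is the Jacobian factor. The identity for the two phases is `cos² + sin² = 1`; it keeps the
oscillation from making both packets small, without any averaging argument. -/
theorem exists_norm_wavePacket : ∃ κ : ℝ, 0 < κ ∧ ∀ Ψ : 𝓢(EuclideanSpace ℝ (Fin d), ℂ),
    (∀ θ, ‖(wavePacket D θ Ψ).toLp 2 volume‖ ≤ κ * ‖Ψ.toLp 2 volume‖) ∧
    ‖(wavePacket D 0 Ψ).toLp 2 volume‖ ^ 2 +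
      ‖(wavePacket D (Real.pi / 2) Ψ).toLp 2 volume‖ ^ 2 = (κ * ‖Ψ.toLp 2 volume‖) ^ 2 := by
  obtain ⟨κ, hκ, h⟩ := exists_integral_comp_eq D
  have hi : ∀ Ψ : 𝓢(EuclideanSpace ℝ (Fin d), ℂ), Integrable fun x => ‖Ψ (D x)‖ ^ 2 := fun Ψ =>
    integrable_norm_sq (SchwartzMap.compCLMOfContinuousLinearEquiv ℂ D Ψ)
  have hn : ∀ (θ : ℝ) (Ψ : 𝓢(EuclideanSpace ℝ (Fin d), ℂ)) (x : EuclideanSpace ℝ (Fin d)),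
      ‖wavePacket D θ Ψ x‖ ^ 2 = Real.cos (x 0 + θ) ^ 2 * ‖Ψ (D x)‖ ^ 2 := fun θ Ψ x => by
    rw [wavePacket_apply, norm_mul, mul_pow, Complex.norm_real, Real.norm_eq_abs, sq_abs]
  refine ⟨κ, hκ, fun Ψ => ⟨fun θ => ?_, ?_⟩⟩
  · refine le_of_sq_le_sq ?_ (by positivity)
    rw [mul_pow, norm_toLp_sq, norm_toLp_sq, ← h fun x => ‖Ψ x‖ ^ 2]
    refine integral_mono (integrable_norm_sq _) (hi Ψ) fun x => ?_
    rw [hn]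
    exact mul_le_of_le_one_left (by positivity) (Real.cos_sq_le_one _)
  · rw [mul_pow, norm_toLp_sq, norm_toLp_sq, norm_toLp_sq, ← h fun x => ‖Ψ x‖ ^ 2,
      ← integral_add (integrable_norm_sq _) (integrable_norm_sq _)]
    refine integral_congr_ae (ae_of_all _ fun x => ?_)
    simp only [hn, add_zero, Real.cos_add_pi_div_two]
    linear_combination ‖Ψ (D x)‖ ^ 2 * Real.cos_sq_add_sin_sq (x 0)

omit [NeZero d] in
theorem exists_schwartz_bump : ∃ Φ : 𝓢(EuclideanSpace ℝ (Fin d), ℂ),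
    (∀ x, starRingEnd ℂ (Φ x) = Φ x) ∧ (∀ x, Φ x ≠ 0 → ‖x‖ < 1) ∧ Φ.toLp 2 volume ≠ 0 := by
  let f : ContDiffBump (0 : EuclideanSpace ℝ (Fin d)) := ⟨1 / 2, 1, by norm_num, by norm_num⟩
  have h1 : HasCompactSupport (Complex.ofRealCLM ∘ f) := f.hasCompactSupport.comp_left rfl
  have h2 : ContDiff ℝ (⊤ : ℕ∞) (Complex.ofRealCLM ∘ f) :=
    Complex.ofRealCLM.contDiff.comp f.contDiff
  have hΦ : ∀ x, h1.toSchwartzMap h2 x = (f x : ℂ) := fun _ => rfl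
  refine ⟨h1.toSchwartzMap h2, fun x => by rw [hΦ, Complex.conj_ofReal], fun x hx => ?_, ?_⟩
  · rw [hΦ] at hx
    have h3 : x ∈ Function.support f := by simpa using hx
    rw [f.support_eq] at h3
    simpa [f] using h3
  · intro h0
    have h3 : h1.toSchwartzMap h2 = 0 := by
      refine SchwartzMap.injective_toLp 2 volume ?_
      change (h1.toSchwartzMap h2).toLp 2 volume = _
      rw [h0]
      exact (map_zero (SchwartzMap.toLpCLM ℂ ℂ 2
        (volume : Measure (EuclideanSpace ℝ (Fin d))))).symm
    have h4 := DFunLike.congr_fun h3 0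
    rw [hΦ, f.one_of_mem_closedBall (by simp [f])] at h4
    simp at h4

/-- The scaling weights adapted to the tube. -/
def tubeWeights (d : ℕ) [NeZero d] (ε : ℝ) (i : Fin d) : ℝ := if i = 0 then ε else √ε

theorem tubeWeights_ne_zero {ε : ℝ} (hε : 0 < ε) (i : Fin d) : tubeWeights d ε i ≠ 0 := by
  unfold tubeWeights
  split_ifs
  · exact hε.ne'
  · exact (Real.sqrt_pos.mpr hε).ne'

theorem mem_tube_of_norm_diagEquiv_lt {ε : ℝ} (hε : 0 < ε) {x : EuclideanSpace ℝ (Fin d)}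
    (hx : ‖diagEquiv (tubeWeights d ε) (tubeWeights_ne_zero hε) x‖ < 1) : x ∈ tube d ε := by
  have h1 : ‖diagEquiv (tubeWeights d ε) (tubeWeights_ne_zero hε) x‖ ^ 2 =
      ε ^ 2 * x 0 ^ 2 + ε * ∑ i ∈ Finset.univ.erase (0 : Fin d), x i ^ 2 := by
    rw [EuclideanSpace.norm_sq_eq, ← Finset.add_sum_erase _ _ (Finset.mem_univ (0 : Fin d)),
      Finset.mul_sum]
    congr 1
    · rw [diagEquiv_apply, tubeWeights, if_pos rfl, Real.norm_eq_abs, sq_abs, mul_pow]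
    · refine Finset.sum_congr rfl fun i hi => ?_
      rw [diagEquiv_apply, tubeWeights, if_neg (Finset.ne_of_mem_erase hi), Real.norm_eq_abs,
        sq_abs, mul_pow, Real.sq_sqrt hε.le]
  have h2 : ‖diagEquiv (tubeWeights d ε) (tubeWeights_ne_zero hε) x‖ ^ 2 < 1 :=
    pow_lt_one₀ (norm_nonneg _) hx two_ne_zero
  rw [h1] at h2
  have h3 : 0 ≤ ∑ i ∈ Finset.univ.erase (0 : Fin d), x i ^ 2 :=
    Finset.sum_nonneg fun _ _ => sq_nonneg _
  constructor
  · refine abs_lt_of_sq_lt_sq ?_ (by positivity)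
    rw [inv_pow, ← one_div, lt_div_iff₀ (by positivity)]
    nlinarith
  · rw [Real.sqrt_lt' (Real.rpow_pos_of_pos hε _), ← Real.rpow_natCast, ← Real.rpow_mul hε.le,
      show (-1 / 2 : ℝ) * (2 : ℕ) = -1 by norm_num, Real.rpow_neg_one, ← one_div,
      lt_div_iff₀ hε]
    nlinarith [mul_nonneg (sq_nonneg ε) (sq_nonneg (x 0))]

theorem tubeWeights_sq_le {ε : ℝ} (hε : 0 < ε) (i : Fin d) :
    tubeWeights d ε i ^ 2 ≤ ε + ε ^ 2 := by
  unfold tubeWeights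
  split_ifs
  · linarith
  · rw [Real.sq_sqrt hε.le]
    nlinarith

/-- The real part `1` of `z_ε` cancels the second derivative of the cosine. What remains carries a
factor `ε` or a squared weight, which is `ε²` or `ε`. -/
theorem helmholtz_wavePacket {ε : ℝ} (hε : 0 < ε) (θ : ℝ) (Φ : 𝓢(EuclideanSpace ℝ (Fin d), ℂ)) :
    -Δ (wavePacket (diagEquiv (tubeWeights d ε) (tubeWeights_ne_zero hε)) θ Φ) -
        zEps ε • wavePacket (diagEquiv (tubeWeights d ε) (tubeWeights_ne_zero hε)) θ Φ =
      -((Complex.I * ε) •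
          wavePacket (diagEquiv (tubeWeights d ε) (tubeWeights_ne_zero hε)) θ Φ) -
        (2 * ε : ℂ) • wavePacket (diagEquiv (tubeWeights d ε) (tubeWeights_ne_zero hε))
          (θ + Real.pi / 2) (∂_{EuclideanSpace.single (0 : Fin d) (1 : ℝ)} Φ) -
        ∑ i, ((tubeWeights d ε i : ℂ) ^ 2) •
          wavePacket (diagEquiv (tubeWeights d ε) (tubeWeights_ne_zero hε)) θ
            (∂_{EuclideanSpace.single i (1 : ℝ)} (∂_{EuclideanSpace.single i (1 : ℝ)} Φ)) := by
  have h0 : (tubeWeights d ε 0 : ℂ) = ε := by simp [tubeWeights]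
  rw [laplacian_wavePacket, h0, zEps]
  module

theorem norm_helmholtz_wavePacket_le {ε : ℝ} (hε : 0 < ε) {κ : ℝ} (hκ : 0 < κ)
    {N : Seminorm ℂ 𝓢(EuclideanSpace ℝ (Fin d), ℂ)}
    (hle : ∀ θ Ψ, N (wavePacket (diagEquiv (tubeWeights d ε) (tubeWeights_ne_zero hε)) θ Ψ) ≤
      κ * N Ψ) (θ : ℝ) (Φ : 𝓢(EuclideanSpace ℝ (Fin d), ℂ)) :
    N (-Δ (wavePacket (diagEquiv (tubeWeights d ε) (tubeWeights_ne_zero hε)) θ Φ) -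
        zEps ε • wavePacket (diagEquiv (tubeWeights d ε) (tubeWeights_ne_zero hε)) θ Φ) ≤
      (ε + ε ^ 2) * (κ * (N Φ + 2 * N (∂_{EuclideanSpace.single (0 : Fin d) (1 : ℝ)} Φ) +
        ∑ i : Fin d, N (∂_{EuclideanSpace.single i (1 : ℝ)}
          (∂_{EuclideanSpace.single i (1 : ℝ)} Φ)))) := by
  have hI : ‖Complex.I * (ε : ℂ)‖ = ε := by simp [abs_of_pos hε]
  have h2 : ‖(2 * ε : ℂ)‖ = 2 * ε := by simp [abs_of_pos hε]
  rw [helmholtz_wavePacket hε]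
  calc _ ≤ ε * (κ * N Φ) + 2 * ε * (κ * N (∂_{EuclideanSpace.single (0 : Fin d) (1 : ℝ)} Φ)) +
          ∑ i : Fin d, (ε + ε ^ 2) * (κ * N (∂_{EuclideanSpace.single i (1 : ℝ)}
            (∂_{EuclideanSpace.single i (1 : ℝ)} Φ))) := by
        refine (map_sub_le_add N _ _).trans (add_le_add ((map_sub_le_add N _ _).trans
          (add_le_add ?_ ?_)) ((Finset.le_sum_of_subadditive N (map_zero N).le
          (map_add_le_add N) _ _).trans (Finset.sum_le_sum fun i _ => ?_)))
        · rw [map_neg_eq_map, map_smul_eq_mul, hI]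
          exact mul_le_mul_of_nonneg_left (hle _ _) hε.le
        · rw [map_smul_eq_mul, h2]
          exact mul_le_mul_of_nonneg_left (hle _ _) (by positivity)
        · rw [map_smul_eq_mul, norm_pow, Complex.norm_real, Real.norm_eq_abs, sq_abs]
          exact mul_le_mul (tubeWeights_sq_le hε i) (hle _ _) (apply_nonneg _ _) (by positivity)
    _ ≤ _ := by
        rw [← Finset.mul_sum, ← Finset.mul_sum]
        have h3 : 0 ≤ ε ^ 2 * (κ * N Φ) :=
          mul_nonneg (sq_nonneg ε) (mul_nonneg hκ.le (apply_nonneg _ _))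
        have h4 : 0 ≤ ε ^ 2 * (κ * N (∂_{EuclideanSpace.single (0 : Fin d) (1 : ℝ)} Φ)) :=
          mul_nonneg (sq_nonneg ε) (mul_nonneg hκ.le (apply_nonneg _ _))
        linarith

theorem exists_test_function (d : ℕ) [NeZero d] : ∃ C : ℝ, 0 < C ∧ ∀ ε : ℝ, 0 < ε →
    ∃ h : 𝓢(EuclideanSpace ℝ (Fin d), ℂ), (∀ x, starRingEnd ℂ (h x) = h x) ∧
      (∀ x, x ∉ tube d ε → h x = 0) ∧ h.toLp 2 volume ≠ 0 ∧
      ‖(-Δ h - zEps ε • h).toLp 2 volume‖ ≤ C * (ε + ε ^ 2) * ‖h.toLp 2 volume‖ := by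
  obtain ⟨Φ, hreal, hsupp, hΦ0⟩ := exists_schwartz_bump (d := d)
  obtain ⟨N, hN⟩ : ∃ N : Seminorm ℂ 𝓢(EuclideanSpace ℝ (Fin d), ℂ),
      ∀ Ψ, ‖Ψ.toLp 2 volume‖ = N Ψ :=
    ⟨(normSeminorm ℂ (L2 d)).comp (SchwartzMap.toLpCLM ℂ ℂ 2 volume).toLinearMap, fun _ => rfl⟩
  simp only [ne_eq, ← norm_eq_zero (a := SchwartzMap.toLp _ 2 volume), hN] at hΦ0 ⊢
  have hpos : 0 < N Φ := lt_of_le_of_ne (apply_nonneg _ _) (Ne.symm hΦ0)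
  obtain ⟨M, hM⟩ : ∃ M : ℝ, M = N Φ + 2 * N (∂_{EuclideanSpace.single (0 : Fin d) (1 : ℝ)} Φ) +
    ∑ i : Fin d, N (∂_{EuclideanSpace.single i (1 : ℝ)} (∂_{EuclideanSpace.single i (1 : ℝ)} Φ)) :=
      ⟨_, rfl⟩
  have hMpos : 0 < M := by
    rw [hM]
    exact add_pos_of_pos_of_nonneg (add_pos_of_pos_of_nonneg hpos
      (mul_nonneg zero_le_two (apply_nonneg _ _)))
      (Finset.sum_nonneg fun i _ => apply_nonneg _ _)
  -- `M` collects the derivatives of the fixed bump; the `2` is lost in choosing the phase.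
  refine ⟨2 * M / N Φ, by positivity, fun ε hε => ?_⟩
  obtain ⟨κ, hκ, hW⟩ := exists_norm_wavePacket
    (diagEquiv (tubeWeights d ε) (tubeWeights_ne_zero hε))
  simp only [hN] at hW
  have hle := norm_helmholtz_wavePacket_le hε hκ fun θ Ψ => (hW Ψ).1 θ
  have hκpos : 0 < κ * N Φ := mul_pos hκ hpos
  -- If both phases fell below half of `κ * N Φ`, their squares could not add up to `(κ * N Φ) ^ 2`.
  obtain ⟨θ, hθ⟩ : ∃ θ : ℝ, κ * N Φ ≤
      2 * N (wavePacket (diagEquiv (tubeWeights d ε) (tubeWeights_ne_zero hε)) θ Φ) := by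
    by_contra! hcon
    have h1 := hcon 0
    have h2 := hcon (Real.pi / 2)
    have h3 := (hW Φ).2
    have h5 := apply_nonneg N (wavePacket (diagEquiv (tubeWeights d ε)
      (tubeWeights_ne_zero hε)) 0 Φ)
    have h6 := apply_nonneg N (wavePacket (diagEquiv (tubeWeights d ε)
      (tubeWeights_ne_zero hε)) (Real.pi / 2) Φ)
    nlinarith
  refine ⟨wavePacket (diagEquiv (tubeWeights d ε) (tubeWeights_ne_zero hε)) θ Φ, fun x => ?_, fun x hx => ?_, fun h0 => ?_, ?_⟩
  · rw [wavePacket_apply, map_mul, hreal, Complex.conj_ofReal]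
  · rw [wavePacket_apply]
    by_contra hne
    exact hx (mem_tube_of_norm_diagEquiv_lt hε (hsupp _ (right_ne_zero_of_mul hne)))
  · rw [h0, mul_zero] at hθ
    exact absurd hθ (not_le.mpr hκpos)
  · refine (hle θ Φ).trans ?_
    rw [← hM]
    calc (ε + ε ^ 2) * (κ * M) = (M / N Φ * (ε + ε ^ 2)) * (κ * N Φ) := by
          field_simp
      _ ≤ (M / N Φ * (ε + ε ^ 2)) * (2 * N (wavePacket _ θ Φ)) :=
          mul_le_mul_of_nonneg_left hθ (by positivity)
      _ = _ := by ring

end TestFunction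

end Analysis

/-! ### Integrals over the tube. -/

section Tube

variable {d : ℕ} [NeZero d]

theorem measurableSet_tube (ε : ℝ) : MeasurableSet (tube d ε) := by
  have h1 : Continuous fun x : EuclideanSpace ℝ (Fin d) => |x 0| := by fun_prop
  have h2 : Continuous fun x : EuclideanSpace ℝ (Fin d) =>
      √(∑ i ∈ Finset.univ.erase (0 : Fin d), x i ^ 2) := by fun_prop
  exact (measurableSet_lt h1.measurable measurable_const).inter
    (measurableSet_lt h2.measurable measurable_const)

theorem volume_tube_ne_top (ε : ℝ) : volume (tube d ε) ≠ ∞ := by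
  set R := √((ε⁻¹) ^ 2 + (ε ^ (-1 / 2 : ℝ)) ^ 2) with hR
  have hball : volume (Metric.closedBall (0 : EuclideanSpace ℝ (Fin d)) R) ≠ ∞ :=
    measure_closedBall_lt_top.ne
  refine measure_ne_top_of_subset (fun x hx => ?_) hball
  obtain ⟨h1, h2⟩ := hx
  rw [mem_closedBall_zero_iff]
  refine Real.le_sqrt_of_sq_le ?_
  rw [EuclideanSpace.norm_sq_eq, ← Finset.add_sum_erase _ _ (Finset.mem_univ (0 : Fin d))]
  have h3 : 0 ≤ ∑ i ∈ Finset.univ.erase (0 : Fin d), x i ^ 2 :=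
    Finset.sum_nonneg fun _ _ => sq_nonneg _
  have h4 : ∑ i ∈ Finset.univ.erase (0 : Fin d), x i ^ 2 ≤ (ε ^ (-1 / 2 : ℝ)) ^ 2 := by
    rw [← Real.sq_sqrt h3]
    exact pow_le_pow_left₀ (Real.sqrt_nonneg _) h2.le 2
  simp only [Real.norm_eq_abs]
  refine add_le_add (pow_le_pow_left₀ (abs_nonneg _) h1.le 2) ?_
  simpa only [sq_abs] using h4

theorem abs_lt_of_mem_tube {ε : ℝ} {x : EuclideanSpace ℝ (Fin d)} (hx : x ∈ tube d ε) {i : Fin d}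
    (hi : i ≠ 0) : |x i| < ε ^ (-1 / 2 : ℝ) := by
  refine lt_of_le_of_lt ?_ hx.2
  rw [← Real.sqrt_sq_eq_abs]
  exact Real.sqrt_le_sqrt (Finset.single_le_sum (f := fun i => x i ^ 2)
    (fun _ _ => sq_nonneg _) (Finset.mem_erase.mpr ⟨hi, Finset.mem_univ i⟩))

theorem integral_exp_neg_mul_abs_sub {b : ℝ} (hb : 0 < b) (c : ℝ) :
    ∫ t : ℝ, Real.exp (-b * |t - c|) = 2 / b := by
  rw [integral_sub_right_eq_self (fun t : ℝ => Real.exp (-b * |t|)) c,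
    integral_comp_abs (f := fun t => Real.exp (-b * t)), integral_exp_mul_Ioi (by linarith)]
  simp
  ring

/-- The one-dimensional factors of the product majorant of `χ_ε(x) exp(-b |x - y|)`. -/
def tubeFactor (d : ℕ) [NeZero d] (ε b c : ℝ) (i : Fin d) (t : ℝ) : ℝ :=
  if i = 0 then Real.exp (-b * |t - c|)
  else (Set.Ioo (-ε ^ (-1 / 2 : ℝ)) (ε ^ (-1 / 2 : ℝ))).indicator (fun _ => 1) t

theorem integral_tubeFactor {ε b : ℝ} (hε : 0 < ε) (hb : 0 < b) (c : ℝ) (i : Fin d) :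
    ∫ t, tubeFactor d ε b c i t = if i = 0 then 2 / b else 2 * ε ^ (-1 / 2 : ℝ) := by
  unfold tubeFactor
  split_ifs with hi
  · exact integral_exp_neg_mul_abs_sub hb c
  · have : 0 < ε ^ (-1 / 2 : ℝ) := Real.rpow_pos_of_pos hε _
    rw [integral_indicator measurableSet_Ioo, setIntegral_const, smul_eq_mul, mul_one,
      Real.volume_real_Ioo_of_le (by linarith)]
    ring

theorem integrable_tubeFactor {ε b : ℝ} (hε : 0 < ε) (hb : 0 < b) (c : ℝ) (i : Fin d) :
    Integrable (tubeFactor d ε b c i) := by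
  refine Integrable.of_integral_ne_zero ?_
  rw [integral_tubeFactor hε hb]
  have : 0 < ε ^ (-1 / 2 : ℝ) := Real.rpow_pos_of_pos hε _
  split_ifs <;> positivity

theorem tubeFactor_nonneg (ε b c : ℝ) (i : Fin d) (t : ℝ) : 0 ≤ tubeFactor d ε b c i t := by
  unfold tubeFactor
  split_ifs
  · exact (Real.exp_pos _).le
  · exact Set.indicator_nonneg (fun _ _ => zero_le_one) _

/-- Only the decay along the axis is kept, and the round cross-section is enclosed in a cube, so the
majorant factors over coordinates. -/
theorem exp_le_prod_tubeFactor {ε b : ℝ} (hb : 0 < b) {x : EuclideanSpace ℝ (Fin d)}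
    (hx : x ∈ tube d ε) (y : EuclideanSpace ℝ (Fin d)) :
    Real.exp (-b * ‖x - y‖) ≤ ∏ i, tubeFactor d ε b (y 0) i (x i) := by
  rw [← Finset.mul_prod_erase _ _ (Finset.mem_univ (0 : Fin d)),
    Finset.prod_eq_one (s := Finset.univ.erase (0 : Fin d)), mul_one, tubeFactor, if_pos rfl,
    Real.exp_le_exp]
  · have h1 : |x 0 - y 0| ≤ ‖x - y‖ := PiLp.norm_apply_le (x - y) 0
    nlinarith
  · intro i hi
    rw [tubeFactor, if_neg (Finset.ne_of_mem_erase hi), Set.indicator_of_mem]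
    exact abs_lt.mp (abs_lt_of_mem_tube hx (Finset.ne_of_mem_erase hi))

theorem integral_prod_tubeFactor {ε b : ℝ} (hε : 0 < ε) (hb : 0 < b) (c : ℝ) :
    ∫ x : EuclideanSpace ℝ (Fin d), ∏ i, tubeFactor d ε b c i (x i) =
      2 / b * (2 * ε ^ (-1 / 2 : ℝ)) ^ (d - 1) := by
  have h1 := (EuclideanSpace.volume_preserving_symm_measurableEquiv_toLp (Fin d)).integral_comp
    (MeasurableEquiv.measurableEmbedding _)
    (fun x : Fin d → ℝ => ∏ i, tubeFactor d ε b c i (x i))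
  refine h1.trans ?_
  rw [integral_fintype_prod_volume_eq_prod]
  simp only [integral_tubeFactor hε hb]
  rw [← Finset.mul_prod_erase _ _ (Finset.mem_univ (0 : Fin d)), if_pos rfl]
  congr 1
  rw [Finset.prod_congr rfl (g := fun _ => 2 * ε ^ (-1 / 2 : ℝ))
    (fun i hi => if_neg (Finset.ne_of_mem_erase hi)), Finset.prod_const,
    Finset.card_erase_of_mem (Finset.mem_univ _), Finset.card_univ, Fintype.card_fin]

theorem integrable_prod_tubeFactor {ε b : ℝ} (hε : 0 < ε) (hb : 0 < b) (c : ℝ) :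
    Integrable fun x : EuclideanSpace ℝ (Fin d) => ∏ i, tubeFactor d ε b c i (x i) := by
  have h1 := (EuclideanSpace.volume_preserving_symm_measurableEquiv_toLp
    (Fin d)).integrable_comp_emb (MeasurableEquiv.measurableEmbedding _)
    (g := fun x : Fin d → ℝ => ∏ i, tubeFactor d ε b c i (x i))
  exact h1.mpr (Integrable.fintype_prod fun i => integrable_tubeFactor hε hb c i)

/-- The majorant depends on `y` only through a translation along the axis, so its integral is the
same for every `y`. -/
theorem daviesNath_le {ε b A : ℝ} (hε : 0 < ε) (hb : 0 < b) (hA : 0 ≤ A)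
    {V : EuclideanSpace ℝ (Fin d) → ℂ} (hV : ∀ x, ‖V x‖ ≤ A * tubeIndicator d ε x) :
    daviesNath V b ≤ ENNReal.ofReal
      (A ^ (((d : ℝ) + 1) / 2) * (2 / b * (2 * ε ^ (-1 / 2 : ℝ)) ^ (d - 1))) := by
  have hp : 0 < ((d : ℝ) + 1) / 2 := by positivity
  refine iSup_le fun y => ?_
  rw [← integral_prod_tubeFactor hε hb (y 0), ← integral_const_mul,
    ofReal_integral_eq_lintegral_ofReal ((integrable_prod_tubeFactor hε hb _).const_mul _)
      (ae_of_all _ fun x => mul_nonneg (Real.rpow_nonneg hA _)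
        (Finset.prod_nonneg fun i _ => tubeFactor_nonneg _ _ _ _ _))]
  refine lintegral_mono fun x => ENNReal.ofReal_le_ofReal ?_
  by_cases hx : x ∈ tube d ε
  · have h1 : ‖V x‖ ≤ A := by
      simpa [tubeIndicator, hx] using hV x
    exact mul_le_mul (Real.rpow_le_rpow (norm_nonneg _) h1 hp.le) (exp_le_prod_tubeFactor hb hx y)
      (Real.exp_pos _).le (Real.rpow_nonneg hA _)
  · have h1 : ‖V x‖ = 0 := by
      have := hV x
      simp only [tubeIndicator, Set.indicator_of_notMem hx, mul_zero] at this
      exact le_antisymm this (norm_nonneg _)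
    rw [h1, Real.zero_rpow hp.ne', zero_mul]
    exact mul_nonneg (Real.rpow_nonneg hA _)
      (Finset.prod_nonneg fun i _ => tubeFactor_nonneg _ _ _ _ _)

/-- The exponents of `ε` add up to `(d+1)/2 - 1 - (d-1)/2 = 0`. -/
theorem tube_scaling {ε C b L : ℝ} (hε : 0 < ε) (hC : 0 < C) (hL : 0 < L)
    (hb : L * (ε / 4) ≤ b) :
    (C * ε) ^ (((d : ℝ) + 1) / 2) * (2 / b * (2 * ε ^ (-1 / 2 : ℝ)) ^ (d - 1)) ≤
      C ^ (((d : ℝ) + 1) / 2) * 8 * 2 ^ (d - 1) / L := by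
  have h0 : 0 < L * (ε / 4) := by positivity
  have hd : 1 ≤ d := NeZero.one_le
  have h1 : 2 / b ≤ 8 / L * ε⁻¹ := by
    calc 2 / b ≤ 2 / (L * (ε / 4)) := by gcongr
      _ = 8 / L * ε⁻¹ := by field_simp; norm_num
  have h2 : (ε ^ (-1 / 2 : ℝ)) ^ (d - 1) = ε ^ (-((d : ℝ) - 1) / 2) := by
    rw [← Real.rpow_natCast, ← Real.rpow_mul hε.le, Nat.cast_sub hd]
    congr 1
    push_cast
    ring
  have h3 : ε ^ (((d : ℝ) + 1) / 2) * (ε⁻¹ * ε ^ (-((d : ℝ) - 1) / 2)) = 1 := by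
    rw [← Real.rpow_neg_one ε, ← Real.rpow_add hε, ← Real.rpow_add hε]
    rw [show ((d : ℝ) + 1) / 2 + (-1 + -((d : ℝ) - 1) / 2) = 0 by ring, Real.rpow_zero]
  have h4 : 0 < ε ^ (-1 / 2 : ℝ) := Real.rpow_pos_of_pos hε _
  calc _ ≤ (C * ε) ^ (((d : ℝ) + 1) / 2) *
        (8 / L * ε⁻¹ * (2 * ε ^ (-1 / 2 : ℝ)) ^ (d - 1)) := by gcongr
    _ = C ^ (((d : ℝ) + 1) / 2) * 8 * 2 ^ (d - 1) / L *
        (ε ^ (((d : ℝ) + 1) / 2) * (ε⁻¹ * ε ^ (-((d : ℝ) - 1) / 2))) := by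
      rw [Real.mul_rpow hC.le hε.le, mul_pow, h2]
      ring
    _ = _ := by rw [h3, mul_one]

end Tube

/-! ### The spectral parameter and the conclusion. -/

theorem zEps_re (ε : ℝ) : (zEps ε).re = 1 := by simp [zEps]

theorem zEps_im (ε : ℝ) : (zEps ε).im = ε := by simp [zEps]

theorem one_le_norm_zEps (ε : ℝ) : 1 ≤ ‖zEps ε‖ := by
  simpa [zEps_re] using Complex.abs_re_le_norm (zEps ε)

/-- From `2 Re √z Im √z = ε` and `0 ≤ Re √z ≤ 2`. -/
theorem le_im_sqrt_zEps {ε : ℝ} (hε : 0 < ε) (h1 : ε < 1) :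
    ε / 4 ≤ (Complex.sqrt (zEps ε)).im := by
  have hre : (Complex.sqrt (zEps ε)).re = √((‖zEps ε‖ + (zEps ε).re) / 2) :=
    Complex.cpow_inv_two_re _
  have hn : ‖zEps ε‖ ≤ 2 := by
    refine (Complex.norm_le_abs_re_add_abs_im _).trans ?_
    rw [zEps_re, zEps_im, abs_one, abs_of_pos hε]
    linarith
  have hre2 : (Complex.sqrt (zEps ε)).re ≤ 2 := by
    rw [hre, zEps_re]
    exact Real.sqrt_le_iff.mpr ⟨by norm_num, by linarith⟩
  have hre0 : 0 ≤ (Complex.sqrt (zEps ε)).re := by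
    rw [hre]
    exact Real.sqrt_nonneg _
  have hsq : Complex.sqrt (zEps ε) ^ 2 = zEps ε := by
    simp [Complex.sqrt]
  have him : 2 * (Complex.sqrt (zEps ε)).re * (Complex.sqrt (zEps ε)).im = ε := by
    have := congrArg Complex.im hsq
    rw [sq, Complex.mul_im, zEps_im] at this
    linarith
  have h2 : 0 < (Complex.sqrt (zEps ε)).im := by
    by_contra hneg
    nlinarith
  nlinarith

end

theorem theorem3 (d : ℕ) [NeZero d] (hd : 2 ≤ d) :
    ∃ V : ℝ → EuclideanSpace ℝ (Fin d) → ℂ,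
      -- each potential is bounded, supported in the tube, and produces the eigenvalue
      (∀ ε : ℝ, 0 < ε →
        Measurable (V ε) ∧
        (∃ M : ℝ, ∀ x, ‖V ε x‖ ≤ M * tubeIndicator d ε x) ∧
        IsSchrodingerEigenvalue (V ε) (zEps ε)) ∧
      -- for small parameters the size of the potential is of order at most the parameter
      (∃ C : ℝ, 0 < C ∧ ∃ ε₀ : ℝ, 0 < ε₀ ∧
        ∀ ε : ℝ, 0 < ε → ε < ε₀ → ∀ x, ‖V ε x‖ ≤ C * ε * tubeIndicator d ε x) ∧
      -- the lower bound
      ∃ C' : ℝ, 0 < C' ∧ ∀ L : ℝ, 1 ≤ L →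
        ENNReal.ofReal (C' * L) ≤
          liminf (fun ε : ℝ =>
            ENNReal.ofReal (‖zEps ε‖ ^ (1 / 2 : ℝ)) /
              daviesNath (V ε) (L * (Complex.sqrt (zEps ε)).im)) (𝓝[>] (0 : ℝ)) := by
  obtain ⟨C, hC, hh⟩ := exists_test_function d
  have hex : ∀ ε : ℝ, ∃ V : EuclideanSpace ℝ (Fin d) → ℂ, 0 < ε → Measurable V ∧
      (∀ x, ‖V x‖ ≤ (C * (ε + ε ^ 2)) ^ 2 / ε * tubeIndicator d ε x) ∧
      IsSchrodingerEigenvalue V (zEps ε) := fun ε => by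
    by_cases hε : 0 < ε
    · obtain ⟨h, hreal, hsupp, h0, hK⟩ := hh ε hε
      obtain ⟨V, hV⟩ := exists_potential (z := zEps ε) (by rwa [zEps_im])
        (measurableSet_tube ε) (volume_tube_ne_top ε) hreal hsupp h0
        (K := C * (ε + ε ^ 2)) (by positivity) hK
      rw [zEps_im] at hV
      exact ⟨V, fun _ => hV⟩
    · exact ⟨0, fun h => absurd h hε⟩
  choose V hV using hex
  have hbound : ∀ ε : ℝ, 0 < ε → ε < 1 →
      ∀ x, ‖V ε x‖ ≤ 4 * C ^ 2 * ε * tubeIndicator d ε x := fun ε hε h1 x => by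
    refine ((hV ε hε).2.1 x).trans (mul_le_mul_of_nonneg_right ?_
      (Set.indicator_nonneg (fun _ _ => zero_le_one) x))
    rw [div_le_iff₀ hε]
    have h2 : ε + ε ^ 2 ≤ 2 * ε := by nlinarith
    calc (C * (ε + ε ^ 2)) ^ 2 ≤ (C * (2 * ε)) ^ 2 := by gcongr
      _ = 4 * C ^ 2 * ε * ε := by ring
  refine ⟨V, fun ε hε => ⟨(hV ε hε).1, ⟨_, (hV ε hε).2.1⟩, (hV ε hε).2.2⟩,
    ⟨4 * C ^ 2, by positivity, 1, one_pos, hbound⟩, ?_⟩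
  -- The constant of `tube_scaling` with `4 * C ^ 2` as the size of the potential; it is free of `ε`
  -- and `L`, so `K⁻¹` can serve as the final constant.
  set K : ℝ := (4 * C ^ 2) ^ (((d : ℝ) + 1) / 2) * 8 * 2 ^ (d - 1) with hK
  have hKpos : 0 < K := by positivity
  refine ⟨K⁻¹, by positivity, fun L hL => ?_⟩
  have hLpos : 0 < L := one_pos.trans_le hL
  refine le_liminf_of_le (by isBoundedDefault) ?_
  filter_upwards [Ioo_mem_nhdsGT (one_pos : (0 : ℝ) < 1)] with ε hε
  have him := le_im_sqrt_zEps hε.1 hε.2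
  have hb : L * (ε / 4) ≤ L * (Complex.sqrt (zEps ε)).im :=
    mul_le_mul_of_nonneg_left him hLpos.le
  have hb0 : 0 < L * (Complex.sqrt (zEps ε)).im :=
    lt_of_lt_of_le (mul_pos hLpos (by linarith [hε.1])) hb
  have hF : daviesNath (V ε) (L * (Complex.sqrt (zEps ε)).im) ≤ ENNReal.ofReal (K / L) :=
    (daviesNath_le hε.1 hb0 (mul_nonneg (by positivity) hε.1.le) (hbound ε hε.1 hε.2)).trans
      (ENNReal.ofReal_le_ofReal (tube_scaling hε.1 (by positivity) hLpos hb))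
  have hone : (1 : ℝ) ≤ ‖zEps ε‖ ^ (1 / 2 : ℝ) :=
    Real.one_le_rpow (one_le_norm_zEps ε) (by norm_num)
  calc ENNReal.ofReal (K⁻¹ * L) = ENNReal.ofReal 1 / ENNReal.ofReal (K / L) := by
        rw [← ENNReal.ofReal_div_of_pos (by positivity)]
        congr 1
        field_simp
    _ ≤ _ := ENNReal.div_le_div (ENNReal.ofReal_le_ofReal hone) hF
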